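/- Let $G$ be a (discrete) group and let $\alpha\colon G^3\to \mathrm{U}(1)$ be a normalized 3-cocycle. Let $\mathcal G=\mathcal G(G,\mathrm{U}(1),\alpha)$ be the associated 2-group: its objects are the elements of $G$, every object has automorphism group $\mathrm{U}(1)$, there are no morphisms between different objects, the tensor product is multiplication, and the associator $(x\otimes y)\otimes z\to x\otimes(y\otimes z)$ is $\alpha(x,y,z)$. Let $\Sigma$ be a closed connected orientable surface of genus $\mathsf g\ge 1$ with smooth universal covering $\tilde\Sigma\to\Sigma$, and let $a_1,b_1,\dots,a_{\mathsf g},b_{\mathsf g}$ be generators of $\pi_1\Sigma$ with the single defining relation $\prod_{i=1}^{\mathsf g}[a_i,b_i]=1$. Fix a homomorphism $\tilde\rho\colon\pi_1\Sigma\to G$, and put $g_i=\tilde\rho(a_i)$, $h_i=\tilde\rho(b_i)$. A lift of $\tilde\rho$ to a weak representation is a monoidal functor $F\colon\pi_1\Sigma\to\mathcal G$ (with $\pi_1\Sigma$ viewed as a discrete monoidal category) that is given on objects by $\tilde\rho$. Its structure isomorphisms $F(ab)\to F(a)\otimes F(b)$ are given by a cochain $\tilde\gamma=\tilde\gamma_F\colon(\pi_1\Sigma)^2\to\mathrm{U}(1)$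 with $d\tilde\gamma=\tilde\rho^*\alpha$. Associated with $F$ are the following. * The flat $\mathcal G$-bundle $P_F$ on $\Sigma$ with Čech data $\rho(y,ya)=\tilde\rho(a)$ and $\gamma(y,ya,yab)=\tilde\gamma(a,b)/\tilde\gamma(1,1)$ relative to $\tilde\Sigma\to\Sigma$ (the denominator is $1$ if $F$ is strictly unital). Its underlying $G$-bundle $P_{\tilde\rho}$ depends only on $\tilde\rho$. A 1-morphism between two such bundles is given, on a cover $Z\to\Sigma$ by a surjective submersion with maps $v_1,v_2\colon Z\to\tilde\Sigma$ over $\Sigma$, by locally constant functions $h\colon Z\to G$ and $\eta\colon Z\times_\Sigma Z\to\mathrm{U}(1)$, where $h$ is a 1-morphism of the underlying $G$-bundles and $\eta$ satisfies the corresponding coherence equation involving $\gamma$, $h$ and $\alpha$; every 1-morphism is invertible up to 2-isomorphism. We say that $P_F$ and $P_{F'}$ are isomorphic over $P_{\tilde\rho}$ if there is a 1-morphism $P_F\to P_{F'}$ that induces the identity map of $P_{\tilde\rho}$, that is, if they are isomorphic in the fibre over $P_{\tilde\rho}$ of the forgetful functor from flat $\mathcal G$-bundles to $G$-bundles. * The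 categorified relation $\sigma(F)\colon\prod_{i=1}^{\mathsf g}[g_i,h_i]\to 1$. This is the isomorphism of $\mathcal G$, with label in $\mathrm{U}(1)$, which is composed of the structure isomorphisms of $F$ and of $\mathcal G$ and lifts the relation $\prod_i[a_i,b_i]=1$. It uses the isomorphism $g_i\otimes h_i\to F(c_i)\otimes(h_i\otimes g_i)$, where $c_i=[a_i,b_i]$, that $F$ provides from $a_ib_i=c_i\,b_ia_i$; the resulting isomorphisms $[g_i,h_i]\to F(c_i)$ and the structure isomorphisms of $F$ give $\prod_i[g_i,h_i]\to F(\prod_i c_i)=F(1)\to 1$. * The pairing $\langle\Psi,\tilde\gamma_F\rangle=\prod\tilde\gamma_F(a,b)^{n_{a,b}}\in\mathrm{U}(1)$ with a fundamental cycle $\Psi=\sum n_{a,b}[a|b]$, that is, with an integral 2-cycle of the bar complex of $\pi_1\Sigma$ whose class generates $\mathrm H_2(\pi_1\Sigma;\mathbb Z)\cong\mathbb Z$. Then the chain $$\Psi_0=\sum_{i=1}^{\mathsf g}\bigl([a_i|b_i]-[b_i|a_i]-[c_i|b_ia_i]+[c_i|c_{i+1}\cdots c_{\mathsf g}]\bigr)$$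 is a fundamental cycle, and for any two lifts $F,F'$ of $\tilde\rho$ to weak representations the following hold. 1. $\sigma(F)\cdot\langle\Psi_0,\tilde\gamma_F\rangle=\sigma(F')\cdot\langle\Psi_0,\tilde\gamma_{F'}\rangle$ in $\mathrm{U}(1)$. Thus, up to inversion and a constant that does not depend on the lift, the categorified relation is the pairing of $\tilde\gamma$ with the fundamental cycle $\Psi_0$. 2. The flat $\mathcal G$-bundles $P_F$ and $P_{F'}$ are isomorphic over $P_{\tilde\rho}$ if and only if $\sigma(F)=\sigma(F')$. 3. For every fundamental cycle $\Psi$, the bundles $P_F$ and $P_{F'}$ are isomorphic over $P_{\tilde\rho}$ if and only if $\langle\Psi,\tilde\gamma_F\rangle=\langle\Psi,\tilde\gamma_{F'}\rangle$. -/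

import Mathlib

open CategoryTheory MonoidalCategory
open scoped Manifold ContDiff commutatorElement

namespace FlatTwoBundles

/-! ### The 2-group `𝒢(G, A, α)` -/

/-- A normalized `A`-valued 3-cocycle on a group `G` acting trivially on the abelian group `A`
(written multiplicatively). -/
structure NormalizedCocycle3 (G A : Type*) [Group G] [CommGroup A] where
  toFun : G → G → G → A
  cocycle : ∀ g₀ g₁ g₂ g₃ : G,
    toFun g₁ g₂ g₃ * toFun g₀ (g₁ * g₂) g₃ * toFun g₀ g₁ g₂ =
      toFun (g₀ * g₁) g₂ g₃ * toFun g₀ g₁ (g₂ * g₃)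
  one_left : ∀ g h : G, toFun 1 g h = 1
  one_mid : ∀ g h : G, toFun g 1 h = 1
  one_right : ∀ g h : G, toFun g h 1 = 1

section TwoGroup

variable {G A : Type*} [Group G] [CommGroup A]

instance : CoeFun (NormalizedCocycle3 G A) (fun _ => G → G → G → A) := ⟨NormalizedCocycle3.toFun⟩

/-- The objects of the 2-group `𝒢(G, A, α)`: they are the elements of `G`. -/
@[ext]
structure TwoGroup (α : NormalizedCocycle3 G A) where
  as : G

namespace TwoGroup

variable {α : NormalizedCocycle3 G A}

/-- Morphisms `x ⟶ y` of `𝒢(G, A, α)`: there is none unless `x = y`, and the automorphisms of an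
object are the elements of `A`. -/
@[ext]
structure Hom (x y : TwoGroup α) where
  eq : x.as = y.as
  val : A

instance : Groupoid (TwoGroup α) where
  Hom x y := Hom x y
  id _ := ⟨rfl, 1⟩
  comp f g := ⟨f.eq.trans g.eq, f.val * g.val⟩
  inv f := ⟨f.eq.symm, f.val⁻¹⟩
  id_comp f := Hom.ext (one_mul f.val)
  comp_id f := Hom.ext (mul_one f.val)
  assoc f g h := Hom.ext (mul_assoc f.val g.val h.val)
  inv_comp f := Hom.ext (inv_mul_cancel f.val)
  comp_inv f := Hom.ext (mul_inv_cancel f.val)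

/-- The morphism `x ⟶ y` between equal objects labelled by `a`. -/
def homMk {x y : TwoGroup α} (h : x.as = y.as) (a : A) : x ⟶ y := Hom.mk h a

/-- The label in `A` of a morphism. -/
def label {x y : TwoGroup α} (f : x ⟶ y) : A := Hom.val f

@[ext]
theorem hom_ext {x y : TwoGroup α} {f g : x ⟶ y} (h : label f = label g) : f = g := Hom.ext h

theorem as_eq {x y : TwoGroup α} (f : x ⟶ y) : x.as = y.as := Hom.eq f

@[simp] theorem label_homMk {x y : TwoGroup α} (h : x.as = y.as) (a : A) :
    label (homMk h a : x ⟶ y) = a := rfl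

@[simp] theorem label_id (x : TwoGroup α) : label (𝟙 x) = 1 := rfl

@[simp] theorem label_comp {x y z : TwoGroup α} (f : x ⟶ y) (g : y ⟶ z) :
    label (f ≫ g) = label f * label g := rfl

/-- The isomorphism between equal objects labelled by `a`. -/
def isoMk {x y : TwoGroup α} (h : x.as = y.as) (a : A) : x ≅ y where
  hom := homMk h a
  inv := homMk h.symm a⁻¹
  hom_inv_id := hom_ext (by simp)
  inv_hom_id := hom_ext (by simp)

/-- The tensor product is multiplication in `G` on objects and in `A` on labels, the unitors are
labelled by `1`, and the associator `(x ⊗ y) ⊗ z ⟶ x ⊗ (y ⊗ z)` by `α x y z`. -/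
instance : MonoidalCategory (TwoGroup α) where
  tensorObj x y := ⟨x.as * y.as⟩
  tensorHom f g := homMk (congrArg₂ (· * ·) (as_eq f) (as_eq g)) (label f * label g)
  whiskerLeft x _ _ f := homMk (congrArg (x.as * ·) (as_eq f)) (label f)
  whiskerRight f y := homMk (congrArg (· * y.as) (as_eq f)) (label f)
  tensorUnit := ⟨1⟩
  associator x y z := isoMk (mul_assoc x.as y.as z.as) (α x.as y.as z.as)
  leftUnitor x := isoMk (one_mul x.as) 1
  rightUnitor x := isoMk (mul_one x.as) 1
  tensorHom_def f g := hom_ext (by simp)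
  id_tensorHom_id x y := hom_ext (by simp)
  tensorHom_comp_tensorHom f₁ f₂ g₁ g₂ := hom_ext (by simp [mul_mul_mul_comm])
  whiskerLeft_id x y := hom_ext (by simp)
  id_whiskerRight x y := hom_ext (by simp)
  associator_naturality {x₁ x₂ x₃ y₁ y₂ y₃} f₁ f₂ f₃ := hom_ext (by
    have h₁ := as_eq f₁
    have h₂ := as_eq f₂
    have h₃ := as_eq f₃
    simp [isoMk, h₁, h₂, h₃, mul_comm, mul_assoc])
  leftUnitor_naturality f := hom_ext (by simp [isoMk])
  rightUnitor_naturality f := hom_ext (by simp [isoMk])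
  pentagon w x y z := hom_ext (by
    have h := α.cocycle w.as x.as y.as z.as
    simp only [isoMk, label_comp, label_homMk]
    rw [← h, mul_comm, mul_assoc, mul_comm (α.toFun x.as y.as z.as),
      mul_comm (α.toFun w.as x.as y.as), ← mul_assoc]
    simp only [mul_comm])
  triangle x y := hom_ext (by simp [isoMk, α.one_mid])

@[simp] theorem tensorObj_as (x y : TwoGroup α) : (x ⊗ y).as = x.as * y.as := rfl

@[simp] theorem tensorUnit_as : (𝟙_ (TwoGroup α)).as = 1 := rfl

@[simp] theorem label_tensorHom {x₁ x₂ y₁ y₂ : TwoGroup α} (f : x₁ ⟶ y₁) (g : x₂ ⟶ y₂) :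
    label (f ⊗ₘ g) = label f * label g := rfl

@[simp] theorem label_whiskerLeft (x : TwoGroup α) {y z : TwoGroup α} (f : y ⟶ z) :
    label (x ◁ f) = label f := rfl

@[simp] theorem label_whiskerRight {y z : TwoGroup α} (f : y ⟶ z) (x : TwoGroup α) :
    label (f ▷ x) = label f := rfl

@[simp] theorem label_associator (x y z : TwoGroup α) :
    label (α_ x y z).hom = α x.as y.as z.as := rfl

@[simp] theorem label_leftUnitor (x : TwoGroup α) : label (λ_ x).hom = 1 := rfl

@[simp] theorem label_rightUnitor (x : TwoGroup α) : label (ρ_ x).hom = 1 := rfl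

/-- The object of `𝒢(G, A, α)` given by an element of `G`. -/
abbrev ob (α : NormalizedCocycle3 G A) (g : G) : TwoGroup α := ⟨g⟩

/-- The canonical morphism `g ⊗ g⁻¹ ⟶ 𝟙`, labelled by `1`. -/
def cancel (α : NormalizedCocycle3 G A) (g : G) : ob α g ⊗ ob α g⁻¹ ⟶ 𝟙_ (TwoGroup α) :=
  homMk (mul_inv_cancel g) 1

end TwoGroup

end TwoGroup

/-! ### Weak representations -/

section WeakRep

open TwoGroup Functor.LaxMonoidal Functor.OplaxMonoidal

variable {Γ G A : Type*} [Group Γ] [Group G] [CommGroup A]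

/-- A lift of the homomorphism `ρ : Γ → G` to a weak representation of `Γ` in `𝒢(G, A, α)`, that is,
to a monoidal functor from `Γ`, viewed as a discrete monoidal category, to `𝒢(G, A, α)`. -/
structure WeakRep (α : NormalizedCocycle3 G A) (ρ : Γ →* G) where
  functor : Discrete Γ ⥤ TwoGroup α
  [monoidal : functor.Monoidal]
  obj_as : ∀ a : Γ, (functor.obj ⟨a⟩).as = ρ a

attribute [instance] WeakRep.monoidal

namespace WeakRep

variable {α : NormalizedCocycle3 G A} {ρ : Γ →* G} (F : WeakRep α ρ)

/-- The value of a weak representation on a group element. -/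
abbrev obj (a : Γ) : TwoGroup α := F.functor.obj ⟨a⟩

/-- The 2-cochain `γ̃` of a weak representation: `γ̃ a b` is the label of the structure morphism
`F (a b) ⟶ F a ⊗ F b`. -/
def cochain (a b : Γ) : A := label (δ F.functor ⟨a⟩ ⟨b⟩)

theorem label_map {x y : Discrete Γ} (f : x ⟶ y) : label (F.functor.map f) = 1 := by
  obtain ⟨x⟩ := x
  obtain ⟨y⟩ := y
  obtain rfl : x = y := Discrete.eq_of_hom f
  obtain rfl : f = 𝟙 _ := Subsingleton.elim _ _
  simp

/-- The relation `ρ^* α = d γ̃`. -/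
theorem cochain_coboundary (a b c : Γ) :
    F.cochain b c * F.cochain a (b * c) =
      α (ρ a) (ρ b) (ρ c) * (F.cochain (a * b) c * F.cochain a b) := by
  have h := congrArg label (Functor.OplaxMonoidal.associativity F.functor
    (⟨a⟩ : Discrete Γ) ⟨b⟩ ⟨c⟩)
  simp only [label_comp, label_whiskerRight, label_whiskerLeft, label_associator, label_map,
    one_mul, F.obj_as] at h
  have h' : F.cochain (a * b) c * (F.cochain a b * α (ρ a) (ρ b) (ρ c)) =
      F.cochain a (b * c) * F.cochain b c := h
  rw [mul_comm (F.cochain b c), ← h', ← mul_assoc, mul_comm]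

theorem cochain_one_left (a : Γ) : F.cochain 1 a = F.cochain 1 1 := by
  have h := F.cochain_coboundary 1 1 a
  rw [map_one, α.one_left, one_mul, one_mul, one_mul] at h
  exact mul_left_cancel h

theorem cochain_one_right (a : Γ) : F.cochain a 1 = F.cochain 1 1 := by
  have h := F.cochain_coboundary a 1 1
  simp only [map_one, α.one_right, one_mul, mul_one] at h
  exact (mul_right_cancel h).symm

/-- `g ⊗ h ≅ F a ⊗ F b ≅ F (a b) = F (c (b a)) ≅ F c ⊗ (F b ⊗ F a) ≅ F c ⊗ (h ⊗ g)`, where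
`g = ρ a`, `h = ρ b` and `c` is the commutator of `a` and `b`. -/
def swap (a b : Γ) :
    ob α (ρ a) ⊗ ob α (ρ b) ⟶ F.obj ⁅a, b⁆ ⊗ (ob α (ρ b) ⊗ ob α (ρ a)) :=
  (homMk (F.obj_as a).symm 1 ⊗ₘ homMk (F.obj_as b).symm 1) ≫
    μ F.functor ⟨a⟩ ⟨b⟩ ≫
    F.functor.map (eqToHom (congrArg Discrete.mk (by simp [commutatorElement_def] :
      a * b = ⁅a, b⁆ * (b * a)))) ≫
    δ F.functor ⟨⁅a, b⁆⟩ ⟨b * a⟩ ≫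
    F.obj ⁅a, b⁆ ◁ (δ F.functor ⟨b⟩ ⟨a⟩ ≫ (homMk (F.obj_as b) 1 ⊗ₘ homMk (F.obj_as a) 1))

/-- The commutator `((g ⊗ h) ⊗ g⁻¹) ⊗ h⁻¹` in `𝒢(G, A, α)`. -/
abbrev commObj (α : NormalizedCocycle3 G A) (g h : G) : TwoGroup α :=
  ((ob α g ⊗ ob α h) ⊗ ob α g⁻¹) ⊗ ob α h⁻¹

/-- The isomorphism of the commutator of `ρ a` and `ρ b` in `𝒢(G, A, α)` with `F ⁅a, b⁆`. -/
def commHom (a b : Γ) : commObj α (ρ a) (ρ b) ⟶ F.obj ⁅a, b⁆ :=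
  ((F.swap a b ▷ ob α (ρ a)⁻¹) ▷ ob α (ρ b)⁻¹) ≫
    ((α_ (F.obj ⁅a, b⁆) (ob α (ρ b) ⊗ ob α (ρ a)) (ob α (ρ a)⁻¹)).hom ▷ ob α (ρ b)⁻¹) ≫
    (α_ (F.obj ⁅a, b⁆) ((ob α (ρ b) ⊗ ob α (ρ a)) ⊗ ob α (ρ a)⁻¹) (ob α (ρ b)⁻¹)).hom ≫
    (F.obj ⁅a, b⁆ ◁
      (((α_ (ob α (ρ b)) (ob α (ρ a)) (ob α (ρ a)⁻¹)).hom ▷ ob α (ρ b)⁻¹) ≫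
        ((ob α (ρ b) ◁ cancel α (ρ a)) ▷ ob α (ρ b)⁻¹) ≫
        ((ρ_ (ob α (ρ b))).hom ▷ ob α (ρ b)⁻¹) ≫
        cancel α (ρ b))) ≫
    (ρ_ (F.obj ⁅a, b⁆)).hom

/-- The product of the commutators of the pairs in a list. -/
def commProd (l : List (Γ × Γ)) : Γ := (l.map fun p => ⁅p.1, p.2⁆).prod

/-- The object `[g₁, h₁] ⊗ ([g₂, h₂] ⊗ ⋯)` of `𝒢(G, A, α)`, for the images `gᵢ = ρ aᵢ` and
`hᵢ = ρ bᵢ` of a list of pairs `(aᵢ, bᵢ)`. -/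
def commProdObj (α : NormalizedCocycle3 G A) (ρ : Γ →* G) : List (Γ × Γ) → TwoGroup α
  | [] => 𝟙_ _
  | p :: l => commObj α (ρ p.1) (ρ p.2) ⊗ commProdObj α ρ l

/-- The isomorphism `[g₁, h₁] ⊗ ([g₂, h₂] ⊗ ⋯) ⟶ F (⁅a₁, b₁⁆ ⁅a₂, b₂⁆ ⋯)`. -/
def commProdHom : (l : List (Γ × Γ)) → (commProdObj α ρ l ⟶ F.obj (commProd l))
  | [] => ε F.functor
  | p :: l => (F.commHom p.1 p.2 ⊗ₘ commProdHom l) ≫ μ F.functor ⟨⁅p.1, p.2⁆⟩ ⟨commProd l⟩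

/-- The categorified relation: the isomorphism `σ : ∏ [gᵢ, hᵢ] ⟶ 𝟙` of `𝒢(G, A, α)` by which the
weak representation lifts a relation `∏ ⁅aᵢ, bᵢ⁆ = 1` of `Γ`. -/
def categorifiedRelation (l : List (Γ × Γ)) (hl : commProd l = 1) :
    commProdObj α ρ l ⟶ 𝟙_ (TwoGroup α) :=
  F.commProdHom l ≫ F.functor.map (eqToHom (congrArg Discrete.mk hl)) ≫ η F.functor

end WeakRep

end WeakRep

/-! ### Fundamental cycles -/

section FundamentalCycle

/-- The pairing of an integral 2-chain of the bar complex with a 2-cochain. -/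
noncomputable def pairing {Γ A : Type*} [CommGroup A] (Ψ : Γ × Γ →₀ ℤ) (γ : Γ → Γ → A) : A :=
  Ψ.prod fun p n => γ p.1 p.2 ^ n

/-- `Ψ` is a cycle of the bar complex of `Γ` whose class generates `H₂(Γ; ℤ)`. When `Γ` is the
fundamental group of a closed connected orientable surface of positive genus, `H₂(Γ; ℤ)` is
infinite cyclic, and the two generators are the fundamental classes for the two orientations. -/
def IsFundamentalCycle {Γ : Type} [Group Γ] (Ψ : Γ × Γ →₀ ℤ) : Prop :=
  ∃ h : Ψ ∈ groupHomology.cycles₂ (Rep.trivial ℤ Γ ℤ),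
    Submodule.span ℤ {(groupHomology.H2π (Rep.trivial ℤ Γ ℤ)).hom ⟨Ψ, h⟩} = ⊤

/-- The 2-chain
`∑ᵢ ([aᵢ|bᵢ] - [bᵢ|aᵢ] - [cᵢ|bᵢaᵢ] + [cᵢ|cᵢ₊₁cᵢ₊₂⋯])`, with `cᵢ = ⁅aᵢ, bᵢ⁆`, of the bar complex
determined by a list of pairs `(aᵢ, bᵢ)`. For a single commuting pair it is `[a|b] - [b|a]` up to
degenerate terms. -/
noncomputable def surfaceChain {Γ : Type*} [Group Γ] : List (Γ × Γ) → (Γ × Γ →₀ ℤ)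
  | [] => 0
  | (a, b) :: l =>
    Finsupp.single (a, b) 1 - Finsupp.single (b, a) 1 - Finsupp.single (⁅a, b⁆, b * a) 1 +
      Finsupp.single (⁅a, b⁆, WeakRep.commProd l) 1 + surfaceChain l

/-- The elements `aᵢ, bᵢ` are generators of `Γ` with the single defining relation
`⁅a₁, b₁⁆ ⋯ ⁅a_g, b_g⁆ = 1`. -/
def IsStandardPresentation {Γ : Type*} [Group Γ] {g : ℕ} (a b : Fin g → Γ) : Prop :=
  Function.Surjective (FreeGroup.lift (Sum.elim a b)) ∧
    (FreeGroup.lift (Sum.elim a b)).ker = Subgroup.normalClosure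
      {WeakRep.commProd (List.ofFn fun i : Fin g =>
        (FreeGroup.of (Sum.inl i : Fin g ⊕ Fin g), FreeGroup.of (Sum.inr i)))}

theorem IsStandardPresentation.commProd_eq_one {Γ : Type*} [Group Γ] {g : ℕ} {a b : Fin g → Γ}
    (h : IsStandardPresentation a b) :
    WeakRep.commProd (List.ofFn fun i => (a i, b i)) = 1 := by
  have hr := (h.2.ge (Subgroup.subset_normalClosure rfl) :
    _ ∈ (FreeGroup.lift (Sum.elim a b)).ker)
  rw [MonoidHom.mem_ker] at hr
  rw [← hr, WeakRep.commProd, WeakRep.commProd, map_list_prod, List.map_map, List.map_ofFn,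
    List.map_ofFn]
  congr 2
  funext i
  simp [map_commutatorElement]

end FundamentalCycle

/-! ### Flat 2-group bundles -/

section Bundles

/-- A surjective submersion from a smooth manifold `Y` onto the smooth `d`-manifold `X`. -/
structure Cover (d : ℕ) (X : Type*) [TopologicalSpace X]
    [ChartedSpace (EuclideanSpace ℝ (Fin d)) X] where
  Y : Type
  dim : ℕ
  [top : TopologicalSpace Y]
  [charted : ChartedSpace (EuclideanSpace ℝ (Fin dim)) Y]
  [isManifold : IsManifold (𝓡 dim) ∞ Y]
  [t2 : T2Space Y]
  [secondCountable : SecondCountableTopology Y]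
  proj : Y → X
  isSubmersion : Manifold.IsSubmersion (𝓡 dim) (𝓡 d) ∞ proj
  surjective : Function.Surjective proj

attribute [instance] Cover.top Cover.charted Cover.isManifold Cover.t2 Cover.secondCountable

variable {d : ℕ} {X : Type*} [TopologicalSpace X] [ChartedSpace (EuclideanSpace ℝ (Fin d)) X]

namespace Cover

/-- The fibre product `Y ×_X Y`. -/
abbrev Fib₂ (c : Cover d X) : Type := {p : c.Y × c.Y // c.proj p.1 = c.proj p.2}

/-- The fibre product `Y ×_X Y ×_X Y`. -/
abbrev Fib₃ (c : Cover d X) : Type :=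
  {p : c.Y × c.Y × c.Y // c.proj p.1 = c.proj p.2.1 ∧ c.proj p.2.1 = c.proj p.2.2}

/-- The point `(y₁, y₂)` of `Y ×_X Y`. -/
abbrev mk₂ (c : Cover d X) (y₁ y₂ : c.Y) (h : c.proj y₁ = c.proj y₂) : c.Fib₂ := ⟨(y₁, y₂), h⟩

/-- The point `(y₁, y₂, y₃)` of `Y ×_X Y ×_X Y`. -/
abbrev mk₃ (c : Cover d X) (y₁ y₂ y₃ : c.Y) (h : c.proj y₁ = c.proj y₂)
    (h' : c.proj y₂ = c.proj y₃) : c.Fib₃ := ⟨(y₁, y₂, y₃), h, h'⟩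

end Cover

variable {G A : Type*} [Group G] [CommGroup A]

/-- A surjective submersion `u : Y → X` with a locally constant `G`-valued 1-cocycle on
`Y ×_X Y`. -/
structure CechCocycle (G : Type*) [Group G] (d : ℕ) (X : Type*) [TopologicalSpace X]
    [ChartedSpace (EuclideanSpace ℝ (Fin d)) X] where
  cover : Cover d X
  rho : cover.Fib₂ → G
  isLocallyConstant : IsLocallyConstant rho
  cocycle : ∀ (y₁ y₂ y₃ : cover.Y) (h₁₂ : cover.proj y₁ = cover.proj y₂)
    (h₂₃ : cover.proj y₂ = cover.proj y₃),
    rho (cover.mk₂ y₁ y₃ (h₁₂.trans h₂₃)) =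
      rho (cover.mk₂ y₁ y₂ h₁₂) * rho (cover.mk₂ y₂ y₃ h₂₃)

/-- The total space of the principal `G`-bundle of a cocycle: the quotient of `Y × G` by
`(y₁, ρ(y₁, y₂) g) ∼ (y₂, g)`. -/
def CechCocycle.TotalSpace (P : CechCocycle G d X) : Type _ :=
  Quot fun p q : P.cover.Y × G =>
    ∃ h : P.cover.proj p.1 = P.cover.proj q.1, p.2 = P.rho (P.cover.mk₂ p.1 q.1 h) * q.2

/-- The class in the total space of a pair `(y, g)`. -/
def CechCocycle.mkPoint (P : CechCocycle G d X) (y : P.cover.Y) (g : G) : P.TotalSpace :=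
  Quot.mk _ (y, g)

/-- The flat `𝒢(G, A, α)`-bundles on `X` whose underlying `G`-bundle is the one of the cocycle
`P = (u, ρ)`: the locally constant functions `γ` on `Y ×_X Y ×_X Y` with `ρ^* α = d γ` that are
normalized. -/
structure TwoBundle (α : NormalizedCocycle3 G A) (P : CechCocycle G d X) where
  gamma : P.cover.Fib₃ → A
  isLocallyConstant : IsLocallyConstant gamma
  coboundary : ∀ (y₁ y₂ y₃ y₄ : P.cover.Y) (h₁₂ : P.cover.proj y₁ = P.cover.proj y₂)
    (h₂₃ : P.cover.proj y₂ = P.cover.proj y₃) (h₃₄ : P.cover.proj y₃ = P.cover.proj y₄),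
    α (P.rho (P.cover.mk₂ y₁ y₂ h₁₂)) (P.rho (P.cover.mk₂ y₂ y₃ h₂₃))
        (P.rho (P.cover.mk₂ y₃ y₄ h₃₄)) =
      (gamma (P.cover.mk₃ y₂ y₃ y₄ h₂₃ h₃₄) *
          gamma (P.cover.mk₃ y₁ y₂ y₄ h₁₂ (h₂₃.trans h₃₄))) /
        (gamma (P.cover.mk₃ y₁ y₃ y₄ (h₁₂.trans h₂₃) h₃₄) *
          gamma (P.cover.mk₃ y₁ y₂ y₃ h₁₂ h₂₃))
  normalized_right : ∀ (y₁ y₂ : P.cover.Y) (h : P.cover.proj y₁ = P.cover.proj y₂),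
    gamma (P.cover.mk₃ y₁ y₂ y₂ h rfl) = 1
  normalized_left : ∀ (y₂ y₃ : P.cover.Y) (h : P.cover.proj y₂ = P.cover.proj y₃),
    gamma (P.cover.mk₃ y₂ y₂ y₃ rfl h) = 1

/-- A 1-morphism `(Z, v₁, v₂, h, η)` from the `𝒢(G, A, α)`-bundle `(P₁, γ₁)` to `(P₂, γ₂)`. All
1-morphisms of the bicategory of flat `𝒢(G, A, α)`-bundles are invertible. -/
structure OneMorphism {α : NormalizedCocycle3 G A} {P₁ P₂ : CechCocycle G d X}
    (B₁ : TwoBundle α P₁) (B₂ : TwoBundle α P₂) where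
  Z : Cover d X
  v₁ : Z.Y → P₁.cover.Y
  v₂ : Z.Y → P₂.cover.Y
  smooth_v₁ : ContMDiff (𝓡 Z.dim) (𝓡 P₁.cover.dim) ∞ v₁
  smooth_v₂ : ContMDiff (𝓡 Z.dim) (𝓡 P₂.cover.dim) ∞ v₂
  proj_v₁ : ∀ z, P₁.cover.proj (v₁ z) = Z.proj z
  proj_v₂ : ∀ z, P₂.cover.proj (v₂ z) = Z.proj z
  h : Z.Y → G
  h_isLocallyConstant : IsLocallyConstant h
  h_rho : ∀ (z₁ z₂ : Z.Y) (hz : Z.proj z₁ = Z.proj z₂),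
    P₂.rho (P₂.cover.mk₂ (v₂ z₁) (v₂ z₂) (by rw [proj_v₂, proj_v₂, hz])) * h z₂ =
      h z₁ * P₁.rho (P₁.cover.mk₂ (v₁ z₁) (v₁ z₂) (by rw [proj_v₁, proj_v₁, hz]))
  eta : Z.Fib₂ → A
  eta_isLocallyConstant : IsLocallyConstant eta
  eta_gamma : ∀ (z₁ z₂ z₃ : Z.Y) (h₁₂ : Z.proj z₁ = Z.proj z₂) (h₂₃ : Z.proj z₂ = Z.proj z₃),
    let r₁₂ := P₁.rho (P₁.cover.mk₂ (v₁ z₁) (v₁ z₂) (by rw [proj_v₁, proj_v₁, h₁₂]))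
    let r₂₃ := P₁.rho (P₁.cover.mk₂ (v₁ z₂) (v₁ z₃) (by rw [proj_v₁, proj_v₁, h₂₃]))
    let s₁₂ := P₂.rho (P₂.cover.mk₂ (v₂ z₁) (v₂ z₂) (by rw [proj_v₂, proj_v₂, h₁₂]))
    let s₂₃ := P₂.rho (P₂.cover.mk₂ (v₂ z₂) (v₂ z₃) (by rw [proj_v₂, proj_v₂, h₂₃]))
    eta (Z.mk₂ z₂ z₃ h₂₃) * eta (Z.mk₂ z₁ z₂ h₁₂) / eta (Z.mk₂ z₁ z₃ (h₁₂.trans h₂₃)) =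
      B₁.gamma (P₁.cover.mk₃ (v₁ z₁) (v₁ z₂) (v₁ z₃) (by rw [proj_v₁, proj_v₁, h₁₂])
          (by rw [proj_v₁, proj_v₁, h₂₃])) /
        B₂.gamma (P₂.cover.mk₃ (v₂ z₁) (v₂ z₂) (v₂ z₃) (by rw [proj_v₂, proj_v₂, h₁₂])
          (by rw [proj_v₂, proj_v₂, h₂₃])) *
        (α s₁₂ (h z₂) r₂₃ / (α (h z₁) r₁₂ r₂₃ * α s₁₂ s₂₃ (h z₃)))

/-- A 1-morphism between two `𝒢(G, A, α)`-bundles with the same underlying `G`-bundle covers its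
identity: the map of `G`-bundles `[v₁ z, g] ↦ [v₂ z, h(z) g]` induced by it is the identity. -/
def OneMorphism.CoversIdentity {α : NormalizedCocycle3 G A} {P : CechCocycle G d X}
    {B₁ B₂ : TwoBundle α P} (φ : OneMorphism B₁ B₂) : Prop :=
  ∀ (z : φ.Z.Y) (g : G), P.mkPoint (φ.v₁ z) g = P.mkPoint (φ.v₂ z) (φ.h z * g)

/-- Two `𝒢(G, A, α)`-bundles with the same underlying `G`-bundle are isomorphic over it, i.e. they
are isomorphic in the fibre of the forgetful functor to `G`-bundles. -/
def TwoBundle.IsIsomorphicOver {α : NormalizedCocycle3 G A} {P : CechCocycle G d X}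
    (B₁ B₂ : TwoBundle α P) : Prop :=
  ∃ φ : OneMorphism B₁ B₂, φ.CoversIdentity

end Bundles

/-! ### The 2-group bundle of a weak representation of the fundamental group -/

section Holonomy

/-- A smooth universal covering of `X` with a base point. -/
structure UniversalCover (d : ℕ) (X : Type*) [TopologicalSpace X]
    [ChartedSpace (EuclideanSpace ℝ (Fin d)) X] extends Cover d X where
  isCoveringMap : IsCoveringMap proj
  [simplyConnected : SimplyConnectedSpace Y]
  base : Y

attribute [instance] UniversalCover.simplyConnected

namespace UniversalCover

variable {d : ℕ} {X : Type*} [TopologicalSpace X] [ChartedSpace (EuclideanSpace ℝ (Fin d)) X]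
  (U : UniversalCover d X)

/-- The fundamental group of `X`, based at the image of the base point of the universal covering.
(In Mathlib's convention the product `a * b` is the loop `b` followed by the loop `a`.) -/
abbrev Pi1 : Type _ := FundamentalGroup X (U.proj U.base)

/-- The loop class obtained by projecting a path from the base point to `y₂`, and then the reverse
of a path from the base point to `y₁`. -/
noncomputable def loopOf {y₁ y₂ : U.Y} (h : U.proj y₁ = U.proj y₂) (p₁ : Path U.base y₁)
    (p₂ : Path U.base y₂) : U.Pi1 :=
  Path.Homotopic.Quotient.mk
    (((p₂.map U.isCoveringMap.continuous).cast rfl h).trans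
      (p₁.map U.isCoveringMap.continuous).symm)

/-- The element `a` of the fundamental group with `y₂ = y₁ · a`, for the right action by deck
transformations under which `base · a` is the endpoint of the lift of `a` starting at `base`. -/
noncomputable def diff (y₁ y₂ : U.Y) (h : U.proj y₁ = U.proj y₂) : U.Pi1 :=
  U.loopOf h (PathConnectedSpace.somePath _ _) (PathConnectedSpace.somePath _ _)

theorem diff_eq {y₁ y₂ : U.Y} (h : U.proj y₁ = U.proj y₂) (p₁ : Path U.base y₁)
    (p₂ : Path U.base y₂) : U.diff y₁ y₂ h = U.loopOf h p₁ p₂ := by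
  refine Path.Homotopic.Quotient.eq.mpr (Path.Homotopic.hcomp ?_ ?_)
  · exact (SimplyConnectedSpace.paths_homotopic _ p₂).map ⟨U.proj, U.isCoveringMap.continuous⟩
  · exact ((SimplyConnectedSpace.paths_homotopic _ p₁).map
      ⟨U.proj, U.isCoveringMap.continuous⟩).symm₂

theorem diff_mul (y₁ y₂ y₃ : U.Y) (h₁₂ : U.proj y₁ = U.proj y₂) (h₂₃ : U.proj y₂ = U.proj y₃) :
    U.diff y₁ y₃ (h₁₂.trans h₂₃) = U.diff y₁ y₂ h₁₂ * U.diff y₂ y₃ h₂₃ := by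
  have key : ∀ {x₀ x₁ x₂ x₃ : X} (h : x₁ = x₂) (h' : x₂ = x₃) (q₁ : Path x₀ x₁)
      (q₂ : Path x₀ x₂) (q₃ : Path x₀ x₃),
      Path.Homotopic.Quotient.mk ((q₃.cast rfl (h.trans h')).trans q₁.symm) =
        Path.Homotopic.Quotient.trans
          (Path.Homotopic.Quotient.mk ((q₃.cast rfl h').trans q₂.symm))
          (Path.Homotopic.Quotient.mk ((q₂.cast rfl h).trans q₁.symm)) := by
    intro x₀ x₁ x₂ x₃ h h' q₁ q₂ q₃
    subst h h'
    simp only [Path.Homotopic.Quotient.mk_trans, Path.Homotopic.Quotient.mk_symm,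
      Path.cast_rfl_rfl]
    rw [Path.Homotopic.Quotient.trans_assoc, ← Path.Homotopic.Quotient.trans_assoc _ (.mk q₂),
      Path.Homotopic.Quotient.symm_trans, Path.Homotopic.Quotient.refl_trans]
  exact key h₁₂ h₂₃ _ _ _

theorem diff_self (y : U.Y) : U.diff y y rfl = 1 := by
  have h := U.diff_mul y y y rfl rfl
  exact (mul_eq_left.mp h.symm)

theorem diff_eq_of_paths {y₁ y₂ z₁ z₂ : U.Y} (h : U.proj y₁ = U.proj y₂)
    (h' : U.proj z₁ = U.proj z₂) (r₁ : Path y₁ z₁) (r₂ : Path y₂ z₂)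
    (hr : ∀ t, U.proj (r₁ t) = U.proj (r₂ t)) : U.diff z₁ z₂ h' = U.diff y₁ y₂ h := by
  have key : ∀ {x₀ x₁ x₂ : X} (p q : Path x₀ x₁) (s : Path x₁ x₂),
      Path.Homotopic.Quotient.mk ((p.trans s).trans (q.trans s).symm) =
        Path.Homotopic.Quotient.mk (p.trans q.symm) := by
    intro x₀ x₁ x₂ p q s
    simp only [Path.trans_symm, Path.Homotopic.Quotient.mk_trans, Path.Homotopic.Quotient.mk_symm]
    rw [Path.Homotopic.Quotient.trans_assoc, ← Path.Homotopic.Quotient.trans_assoc (.mk s),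
      Path.Homotopic.Quotient.trans_symm, Path.Homotopic.Quotient.refl_trans]
  have p₁ := PathConnectedSpace.somePath U.base y₁
  have p₂ := PathConnectedSpace.somePath U.base y₂
  rw [U.diff_eq h p₁ p₂, U.diff_eq h' (p₁.trans r₁) (p₂.trans r₂), loopOf, loopOf,
    ← key _ _ (r₁.map U.isCoveringMap.continuous), Path.map_trans p₁]
  congr 2
  ext t
  simp only [Path.cast_coe, Path.map_coe, Function.comp_apply, Path.trans_apply]
  split_ifs
  · rfl
  · exact (hr _).symm

theorem diff_isLocallyConstant :
    IsLocallyConstant fun p : U.toCover.Fib₂ => U.diff p.1.1 p.1.2 p.2 := by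
  have : LocallyPathConnectedSpace X :=
    ChartedSpace.locallyPathConnectedSpace (EuclideanSpace ℝ (Fin d)) X
  rw [IsLocallyConstant.iff_eventually_eq]
  rintro ⟨⟨y₁, y₂⟩, h⟩
  obtain ⟨e₁, he₁, hp₁⟩ := U.isCoveringMap.isLocalHomeomorph y₁
  obtain ⟨e₂, he₂, hp₂⟩ := U.isCoveringMap.isLocalHomeomorph y₂
  have ht₁ : e₁.target ∈ nhds (U.proj y₁) := by
    rw [hp₁]
    exact e₁.open_target.mem_nhds (e₁.map_source he₁)
  have ht₂ : e₂.target ∈ nhds (U.proj y₁) := by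
    rw [h, hp₂]
    exact e₂.open_target.mem_nhds (e₂.map_source he₂)
  obtain ⟨V, ⟨hV, hVc⟩, hVt⟩ :=
    (path_connected_basis (U.proj y₁)).mem_iff.mp (Filter.inter_mem ht₁ ht₂)
  have hc : Continuous fun p : U.toCover.Fib₂ => p.1.1 := by fun_prop
  have hc' : Continuous fun p : U.toCover.Fib₂ => p.1.2 := by fun_prop
  filter_upwards [hc.continuousAt.preimage_mem_nhds (e₁.open_source.mem_nhds he₁),
    hc'.continuousAt.preimage_mem_nhds (e₂.open_source.mem_nhds he₂),
    (U.isCoveringMap.continuous.comp hc).continuousAt.preimage_mem_nhds hV]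
  rintro ⟨⟨z₁, z₂⟩, h'⟩ hz₁ hz₂ hzV
  change z₁ ∈ e₁.source at hz₁
  change z₂ ∈ e₂.source at hz₂
  change U.proj z₁ ∈ V at hzV
  change U.proj z₁ = U.proj z₂ at h'
  change U.proj y₁ = U.proj y₂ at h
  obtain ⟨s, hs⟩ := hVc.joinedIn _ (mem_of_mem_nhds hV) _ hzV
  have hs₁ : Set.range s ⊆ e₁.target := by
    rintro _ ⟨t, rfl⟩
    exact (hVt (hs t)).1
  have hs₂ : Set.range s ⊆ e₂.target := by
    rintro _ ⟨t, rfl⟩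
    exact (hVt (hs t)).2
  refine U.diff_eq_of_paths h h'
    ((s.map' (e₁.continuousOn_symm.mono hs₁)).cast
      (by rw [hp₁, e₁.left_inv he₁]) (by rw [hp₁, e₁.left_inv hz₁]))
    ((s.map' (e₂.continuousOn_symm.mono hs₂)).cast
      (by rw [h, hp₂, e₂.left_inv he₂]) (by rw [h', hp₂, e₂.left_inv hz₂])) fun t => ?_
  have h₁ : U.proj (e₁.symm (s t)) = s t := by
    exact (congrFun hp₁ _).trans (e₁.right_inv (hs₁ ⟨t, rfl⟩))
  have h₂ : U.proj (e₂.symm (s t)) = s t := by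
    exact (congrFun hp₂ _).trans (e₂.right_inv (hs₂ ⟨t, rfl⟩))
  exact h₁.trans h₂.symm

variable {G A : Type*} [Group G] [CommGroup A]

/-- The cocycle `ρ(y, y · a) = ρ̃(a)` on the universal covering. -/
noncomputable abbrev cechCocycle (ρ : U.Pi1 →* G) : CechCocycle G d X where
  cover := U.toCover
  rho p := ρ (U.diff p.1.1 p.1.2 p.2)
  isLocallyConstant := U.diff_isLocallyConstant.comp ρ
  cocycle y₁ y₂ y₃ h₁₂ h₂₃ := by
    rw [← map_mul]
    exact congrArg ρ (U.diff_mul y₁ y₂ y₃ h₁₂ h₂₃)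

theorem cochain_diff_coboundary {α : NormalizedCocycle3 G A} {ρ : U.Pi1 →* G} (F : WeakRep α ρ)
    (y₁ y₂ y₃ y₄ : U.Y) (h₁₂ : U.proj y₁ = U.proj y₂) (h₂₃ : U.proj y₂ = U.proj y₃)
    (h₃₄ : U.proj y₃ = U.proj y₄) :
    α (ρ (U.diff y₁ y₂ h₁₂)) (ρ (U.diff y₂ y₃ h₂₃)) (ρ (U.diff y₃ y₄ h₃₄)) =
      (F.cochain (U.diff y₂ y₃ h₂₃) (U.diff y₃ y₄ h₃₄) / F.cochain 1 1 *
          (F.cochain (U.diff y₁ y₂ h₁₂) (U.diff y₂ y₄ (h₂₃.trans h₃₄)) / F.cochain 1 1)) /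
        (F.cochain (U.diff y₁ y₃ (h₁₂.trans h₂₃)) (U.diff y₃ y₄ h₃₄) / F.cochain 1 1 *
          (F.cochain (U.diff y₁ y₂ h₁₂) (U.diff y₂ y₃ h₂₃) / F.cochain 1 1)) := by
  rw [U.diff_mul y₁ y₂ y₃ h₁₂ h₂₃, U.diff_mul y₂ y₃ y₄ h₂₃ h₃₄, div_mul_div_comm,
    div_mul_div_comm, div_div_div_cancel_right]
  exact eq_div_of_mul_eq' (F.cochain_coboundary _ _ _).symm

/-- The flat 2-group bundle determined by a weak representation of the fundamental group:
`γ(y, y · a, y · ab) = γ̃(a, b)`. The division by the constant `γ̃(1, 1)` normalizes `γ`; it has no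
effect if the weak representation preserves the unit strictly, so that `γ̃` is normalized. -/
noncomputable def twoBundle {α : NormalizedCocycle3 G A} {ρ : U.Pi1 →* G} (F : WeakRep α ρ) :
    TwoBundle α (U.cechCocycle ρ) where
  gamma p := F.cochain (U.diff p.1.1 p.1.2.1 p.2.1) (U.diff p.1.2.1 p.1.2.2 p.2.2) /
    F.cochain 1 1
  isLocallyConstant := by
    have h₁ : Continuous fun p : U.toCover.Fib₃ =>
        (⟨(p.1.1, p.1.2.1), p.2.1⟩ : U.toCover.Fib₂) := by fun_prop
    have h₂ : Continuous fun p : U.toCover.Fib₃ =>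
        (⟨(p.1.2.1, p.1.2.2), p.2.2⟩ : U.toCover.Fib₂) := by fun_prop
    exact (U.diff_isLocallyConstant.comp_continuous h₁).comp₂
      (U.diff_isLocallyConstant.comp_continuous h₂) fun a b => F.cochain a b / F.cochain 1 1
  coboundary y₁ y₂ y₃ y₄ h₁₂ h₂₃ h₃₄ :=
    U.cochain_diff_coboundary F y₁ y₂ y₃ y₄ h₁₂ h₂₃ h₃₄
  normalized_right y₁ y₂ h := by
    rw [div_eq_one]
    exact (congrArg _ (U.diff_self y₂)).trans (F.cochain_one_right _)
  normalized_left y₂ y₃ h := by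
    rw [div_eq_one]
    exact (congrArg (F.cochain · _) (U.diff_self y₂)).trans (F.cochain_one_left _)

end UniversalCover

end Holonomy

end FlatTwoBundles

open FlatTwoBundles

/-! Two lifts of the same homomorphism have cochains with the same coboundary, so `α` cancels in
their quotient `β`, which is an ordinary 2-cocycle of the fundamental group with trivial
coefficients. Everything reduces to deciding when `β` is a coboundary.

Algebraic side: in the central extension defined by `β`, the surface relator evaluated on the lifts
`⟨1, aᵢ⟩`, `⟨1, bᵢ⟩` is the pairing of `β` with the surface chain, up to the unit `β 1 1`
(`CocycleExtension.commProd_map_mk`). If the pairing is trivial, the map from the free group to the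
extension kills the relator. It then descends to a splitting, and `β` is a coboundary
(`IsStandardPresentation.isCoboundary₂`). Applied to the tautological cocycle with values in chains
modulo boundaries and the surface chain, this criterion shows that the surface chain generates `H₂`,
with no separate computation of that group. In the label of the categorified relation, the cochain
enters only through the inverse of this pairing; all other factors are values of `α` on elements of
the image of `ρ`.

Geometric side: a primitive `κ` of `β` gives a 1-morphism on the universal covering with `h = 1`.
Conversely, for a 1-morphism over the identity, `h` is forced by `v₁` and `v₂`, and the second
cochain absorbs the values of `α` (`WeakRep.associator_ratio`). What remains exhibits `β`, up to a
constant, as the Čech coboundary of a locally constant function.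
`UniversalCover.isCoboundary₂_of_cover` brings this back to group cohomology: on the simply
connected total space the relevant locally constant 1-cocycle is trivial, and invariance under deck
transformations produces `κ`. This is the injectivity of `H²(π₁) → H²(X)`, for which asphericity
plays no role. -/

namespace FlatTwoBundles

/-! ### Bilinearity of the pairing of chains with cochains -/

section Pairing

variable {Γ A : Type*} [CommGroup A]

theorem pairing_zero (β : Γ → Γ → A) : pairing 0 β = 1 := Finsupp.prod_zero_index

theorem pairing_add (Ψ Φ : Γ × Γ →₀ ℤ) (β : Γ → Γ → A) :
    pairing (Ψ + Φ) β = pairing Ψ β * pairing Φ β :=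
  Finsupp.prod_add_index' (fun _ => zpow_zero _) fun _ => zpow_add _

theorem pairing_sub (Ψ Φ : Γ × Γ →₀ ℤ) (β : Γ → Γ → A) :
    pairing (Ψ - Φ) β = pairing Ψ β / pairing Φ β := by
  rw [eq_div_iff_mul_eq', ← pairing_add, sub_add_cancel]

theorem pairing_single (a b : Γ) (n : ℤ) (β : Γ → Γ → A) :
    pairing (Finsupp.single (a, b) n) β = β a b ^ n :=
  Finsupp.prod_single_index (zpow_zero _)

theorem pairing_smul (n : ℤ) (Ψ : Γ × Γ →₀ ℤ) (β : Γ → Γ → A) :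
    pairing (n • Ψ) β = pairing Ψ β ^ n := by
  induction Ψ using Finsupp.induction_linear with
  | zero => simp [pairing_zero]
  | add f g hf hg => rw [smul_add, pairing_add, pairing_add, hf, hg, mul_zpow]
  | single p m =>
    obtain ⟨a, b⟩ := p
    rw [Finsupp.smul_single, pairing_single, pairing_single, smul_eq_mul, mul_comm, zpow_mul]

theorem pairing_div (Ψ : Γ × Γ →₀ ℤ) (β β' : Γ → Γ → A) :
    pairing Ψ (fun a b => β a b / β' a b) = pairing Ψ β / pairing Ψ β' := by
  simp only [pairing, div_zpow, Finsupp.prod, Finset.prod_div_distrib]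

end Pairing

/-! ### Central extensions and 2-cocycles of surface groups -/

section GroupCohomology

variable {Γ A : Type*} [Group Γ] [CommGroup A]

/-- The 2-cocycles of a group acting trivially on an abelian group (written multiplicatively). -/
def IsCocycle₂ (β : Γ → Γ → A) : Prop :=
  ∀ a b c, β b c * β a (b * c) = β (a * b) c * β a b

/-- The 2-coboundaries of a group acting trivially on an abelian group. -/
def IsCoboundary₂ (β : Γ → Γ → A) : Prop :=
  ∃ κ : Γ → A, ∀ a b, β a b = κ a * κ b / κ (a * b)

namespace IsCocycle₂

variable {β : Γ → Γ → A}

theorem one_left (hβ : IsCocycle₂ β) (a : Γ) : β 1 a = β 1 1 := by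
  have h := hβ 1 1 a
  rw [one_mul, one_mul] at h
  exact mul_left_cancel h

theorem div {β' : Γ → Γ → A} (hβ : IsCocycle₂ β) (hβ' : IsCocycle₂ β') :
    IsCocycle₂ fun a b => β a b / β' a b := fun a b c => by
  simp only [div_mul_div_comm, hβ a b c, hβ' a b c]

theorem div_const (hβ : IsCocycle₂ β) (x : A) : IsCocycle₂ fun a b => β a b / x :=
  hβ.div fun _ _ _ => rfl

end IsCocycle₂

/-- A constant 2-cochain is the coboundary of the constant 1-cochain with the same value. Hence the
normalization by `γ̃(1, 1)` in the bundle data does not affect the class. -/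
theorem isCoboundary₂_div_const {β : Γ → Γ → A} (x : A) :
    IsCoboundary₂ (fun a b => β a b / x) ↔ IsCoboundary₂ β := by
  constructor
  · rintro ⟨κ, hκ⟩
    refine ⟨fun a => κ a * x, fun a b => ?_⟩
    have h := congrArg Additive.ofMul (hκ a b)
    apply Additive.ofMul.injective
    simp only [ofMul_mul, ofMul_div] at h ⊢
    linear_combination (norm := abel) h
  · rintro ⟨κ, hκ⟩
    refine ⟨fun a => κ a / x, fun a b => ?_⟩
    have h := congrArg Additive.ofMul (hκ a b)
    apply Additive.ofMul.injective
    simp only [ofMul_mul, ofMul_div] at h ⊢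
    linear_combination (norm := abel) h

/-- The central extension of `Γ` by `A` determined by a 2-cocycle. -/
@[ext]
structure CocycleExtension {β : Γ → Γ → A} (hβ : IsCocycle₂ β) where
  fst : A
  snd : Γ

namespace CocycleExtension

variable {β : Γ → Γ → A} {hβ : IsCocycle₂ β}

instance : Mul (CocycleExtension hβ) := ⟨fun x y => ⟨x.fst * y.fst * β x.snd y.snd, x.snd * y.snd⟩⟩

/-- As `β` need not be normalized, the identity carries the correction `(β 1 1)⁻¹`. -/
instance : One (CocycleExtension hβ) := ⟨⟨(β 1 1)⁻¹, 1⟩⟩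

instance : Inv (CocycleExtension hβ) :=
  ⟨fun x => ⟨x.fst⁻¹ * (β x.snd⁻¹ x.snd)⁻¹ * (β 1 1)⁻¹, x.snd⁻¹⟩⟩

@[simp] theorem fst_mul (x y : CocycleExtension hβ) :
    (x * y).fst = x.fst * y.fst * β x.snd y.snd := rfl

@[simp] theorem snd_mul (x y : CocycleExtension hβ) : (x * y).snd = x.snd * y.snd := rfl

@[simp] theorem fst_one : (1 : CocycleExtension hβ).fst = (β 1 1)⁻¹ := rfl

@[simp] theorem snd_one : (1 : CocycleExtension hβ).snd = 1 := rfl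

@[simp] theorem fst_inv (x : CocycleExtension hβ) :
    x⁻¹.fst = x.fst⁻¹ * (β x.snd⁻¹ x.snd)⁻¹ * (β 1 1)⁻¹ := rfl

@[simp] theorem snd_inv (x : CocycleExtension hβ) : x⁻¹.snd = x.snd⁻¹ := rfl

instance : Group (CocycleExtension hβ) :=
  Group.ofLeftAxioms
    (fun x y z => by
      ext
      · have h := hβ x.snd y.snd z.snd
        simp only [fst_mul, snd_mul]
        calc _ = x.fst * y.fst * z.fst * (β (x.snd * y.snd) z.snd * β x.snd y.snd) := by
              simp only [mul_comm, mul_left_comm]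
          _ = _ := by rw [← h]; simp only [mul_comm, mul_left_comm]
      · exact mul_assoc _ _ _)
    (fun x => by
      ext
      · simp [hβ.one_left x.snd]
      · simp)
    (fun x => by
      ext
      · simp [mul_right_comm]
      · simp)

/-- The projection of the extension. -/
def proj (hβ : IsCocycle₂ β) : CocycleExtension hβ →* Γ where
  toFun := snd
  map_one' := rfl
  map_mul' _ _ := rfl

/-- Comparing `xy` with `⁅x, y⁆ (yx)` avoids the formula for inverses. The result accounts for the
first three terms of each summand of the surface chain; the fourth comes from multiplying the
commutators together. -/
theorem commutator_mk (a b : Γ) :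
    ⁅(⟨1, a⟩ : CocycleExtension hβ), (⟨1, b⟩ : CocycleExtension hβ)⁆ =
      ⟨β a b / β b a / β ⁅a, b⁆ (b * a), ⁅a, b⁆⟩ := by
  rw [commutatorElement_def, mul_assoc, ← mul_inv_rev, mul_inv_eq_iff_eq_mul]
  ext
  · simp only [fst_mul, snd_mul, one_mul]
    rw [mul_assoc _ (β b a), mul_comm (β b a), ← mul_assoc, div_mul_cancel, div_mul_cancel]
  · simp [commutatorElement_def]

end CocycleExtension

theorem pairing_surfaceChain_cons (a b : Γ) (l : List (Γ × Γ)) (β : Γ → Γ → A) :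
    pairing (surfaceChain ((a, b) :: l)) β =
      β a b / β b a / β ⁅a, b⁆ (b * a) * β ⁅a, b⁆ (WeakRep.commProd l) *
        pairing (surfaceChain l) β := by
  simp only [surfaceChain, pairing_add, pairing_sub, pairing_single, zpow_one]

theorem CocycleExtension.commProd_map_mk {β : Γ → Γ → A} {hβ : IsCocycle₂ β}
    (l : List (Γ × Γ)) :
    WeakRep.commProd (l.map fun p =>
        ((⟨1, p.1⟩ : CocycleExtension hβ), (⟨1, p.2⟩ : CocycleExtension hβ))) =
      ⟨pairing (surfaceChain l) β / β 1 1, WeakRep.commProd l⟩ := by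
  induction l with
  | nil => ext <;> simp [WeakRep.commProd, surfaceChain, pairing_zero]
  | cons p l ih =>
    obtain ⟨a, b⟩ := p
    have h : WeakRep.commProd (((a, b) :: l).map fun p =>
        ((⟨1, p.1⟩ : CocycleExtension hβ), (⟨1, p.2⟩ : CocycleExtension hβ))) =
        ⁅(⟨1, a⟩ : CocycleExtension hβ), (⟨1, b⟩ : CocycleExtension hβ)⁆ *
          WeakRep.commProd (l.map fun p =>
            ((⟨1, p.1⟩ : CocycleExtension hβ), (⟨1, p.2⟩ : CocycleExtension hβ))) := rfl
    rw [h, ih, commutator_mk, pairing_surfaceChain_cons]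
    ext
    · simp only [fst_mul, div_eq_mul_inv, mul_comm, mul_left_comm, mul_assoc]
    · rfl

theorem map_commProd {Γ' : Type*} [Group Γ'] (φ : Γ →* Γ') (l : List (Γ × Γ)) :
    φ (WeakRep.commProd l) = WeakRep.commProd (l.map (Prod.map φ φ)) := by
  simp only [WeakRep.commProd, map_list_prod, List.map_map]
  congr 2
  funext p
  simp [map_commutatorElement]

/-- A 2-cocycle of a surface group that pairs trivially with the surface chain is a coboundary. -/
theorem IsStandardPresentation.isCoboundary₂ {g : ℕ} {a b : Fin g → Γ}
    (hab : IsStandardPresentation a b) {β : Γ → Γ → A} (hβ : IsCocycle₂ β)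
    (h : pairing (surfaceChain (List.ofFn fun i => (a i, b i))) β = 1) : IsCoboundary₂ β := by
  set π := FreeGroup.lift (Sum.elim a b) with hπ
  -- The free group can be mapped to the extension by any choice of lifts; first component `1` makes
  -- the relator's value the pairing with the surface chain.
  let φ : FreeGroup (Fin g ⊕ Fin g) →* CocycleExtension hβ :=
    FreeGroup.lift fun i => ⟨1, Sum.elim a b i⟩
  have hφπ : (CocycleExtension.proj hβ).comp φ = π := by
    ext i
    simp [φ, π, CocycleExtension.proj]
  have hker : π.ker ≤ φ.ker := by
    rw [hπ, hab.2]
    refine Subgroup.normalClosure_le_normal ?_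
    rw [Set.singleton_subset_iff, SetLike.mem_coe, MonoidHom.mem_ker, map_commProd]
    have hl : List.map (Prod.map φ φ) (List.ofFn fun i : Fin g =>
        (FreeGroup.of (Sum.inl i : Fin g ⊕ Fin g), FreeGroup.of (Sum.inr i))) =
        (List.ofFn fun i => (a i, b i)).map fun p =>
          ((⟨1, p.1⟩ : CocycleExtension hβ), (⟨1, p.2⟩ : CocycleExtension hβ)) := by
      simp only [List.map_ofFn]
      congr 1
      funext i
      simp [φ]
    rw [hl, CocycleExtension.commProd_map_mk, h, hab.commProd_eq_one]
    ext <;> simp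
  have hfst : ∀ x y, π x = π y → φ x = φ y := fun x y hxy => by
    rw [← inv_mul_eq_one, ← map_inv, ← map_mul]
    exact hker (by rw [MonoidHom.mem_ker, map_mul, map_inv, hxy, inv_mul_cancel])
  choose s hs using hab.1
  -- As `φ` factors through `π`, `x ↦ φ (s x)` is a multiplicative section. Its first component `f`
  -- satisfies `f (xy) = f x * f y * β x y`, so the primitive is `f⁻¹`.
  refine ⟨fun x => (φ (s x)).fst⁻¹, fun x y => ?_⟩
  have hsnd : ∀ x, (φ (s x)).snd = x := fun x =>
    (DFunLike.congr_fun hφπ (s x)).trans (hs x)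
  have hmul : φ (s (x * y)) = φ (s x) * φ (s y) := by
    rw [← map_mul]
    exact hfst _ _ (by rw [map_mul]; exact (hs _).trans (congrArg₂ _ (hs x) (hs y)).symm)
  dsimp only
  rw [hmul, CocycleExtension.fst_mul, hsnd, hsnd, div_inv_eq_mul, ← mul_inv,
    inv_mul_cancel_left]

end GroupCohomology

/-! ### The surface chain as a generator of the second homology -/

section Homology

open groupHomology

variable {Γ : Type} {A : Type*} [Group Γ] [CommGroup A]

/-- The cocycle identity says exactly that the pairing with the boundary of each `[a|b|c]` is
trivial. -/
theorem pairing_of_mem_boundaries₂ {Ψ : Γ × Γ →₀ ℤ}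
    (hΨ : Ψ ∈ boundaries₂ (Rep.trivial ℤ Γ ℤ)) {β : Γ → Γ → A} (hβ : IsCocycle₂ β) :
    pairing Ψ β = 1 := by
  obtain ⟨x, rfl⟩ := hΨ
  induction x using Finsupp.induction_linear with
  | zero => rw [map_zero]; exact pairing_zero β
  | add f g hf hg => rw [map_add]; exact (pairing_add _ _ β).trans (by rw [hf, hg, one_mul])
  | single p n =>
    obtain ⟨a, b, c⟩ := p
    have h : pairing (Finsupp.single (b, c) n - Finsupp.single (a * b, c) n +
        Finsupp.single (a, b * c) n - Finsupp.single (a, b) n) β = 1 := by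
      simp only [pairing_sub, pairing_add, pairing_single]
      rw [div_mul_eq_mul_div, div_div, ← mul_zpow, ← mul_zpow, hβ a b c, div_self']
    exact (congrArg (pairing · β) (d₃₂_single (A := Rep.trivial ℤ Γ ℤ) (a, b, c) n)).trans h

theorem d₂₁_single_trivial (a b : Γ) (n : ℤ) :
    (d₂₁ (Rep.trivial ℤ Γ ℤ)).hom (Finsupp.single (a, b) n) =
      Finsupp.single b n - Finsupp.single (a * b) n + Finsupp.single a n :=
  d₂₁_single (A := Rep.trivial ℤ Γ ℤ) (a, b) n

theorem pairing_of_isCoboundary₂ {Ψ : Γ × Γ →₀ ℤ} (hΨ : Ψ ∈ cycles₂ (Rep.trivial ℤ Γ ℤ))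
    {β : Γ → Γ → A} (hβ : IsCoboundary₂ β) : pairing Ψ β = 1 := by
  obtain ⟨κ, hκ⟩ := hβ
  -- Evaluation of 1-chains on `κ`; the pairing with the coboundary of `κ` is this evaluation after
  -- the differential, as `key` shows on generators.
  let ev : (Γ →₀ ℤ) →+ Additive A :=
    Finsupp.liftAddHom fun a => (zmultiplesHom (Additive A)) (Additive.ofMul (κ a))
  have hev : ∀ a n, ev (Finsupp.single a n) = Additive.ofMul (κ a ^ n) := fun a n => by
    simp [ev]
  have key : ∀ Φ : Γ × Γ →₀ ℤ, Additive.ofMul (pairing Φ β) =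
      ev ((d₂₁ (Rep.trivial ℤ Γ ℤ)).hom Φ) := by
    intro Φ
    induction Φ using Finsupp.induction_linear with
    | zero => rw [map_zero, pairing_zero]; exact (map_zero ev).symm
    | add f g hf hg =>
      rw [map_add, pairing_add, ofMul_mul, hf, hg]
      exact (map_add ev _ _).symm
    | single p n =>
      obtain ⟨a, b⟩ := p
      rw [d₂₁_single_trivial, pairing_single, map_add, map_sub, hev, hev, hev, ← ofMul_div,
        ← ofMul_mul, hκ, div_zpow, mul_zpow, div_mul_eq_mul_div, mul_comm (κ b ^ n)]
  have h := key Ψ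
  rw [LinearMap.mem_ker.mp hΨ] at h
  exact Additive.ofMul.injective (h.trans (map_zero ev))

/-- The terms telescope: within a summand the boundaries of the first three simplices leave `-[c]`,
and `[c|c']` replaces `[c] + [c']` by `[cc']`. The `[1]` comes from the empty product. -/
theorem d₂₁_surfaceChain (l : List (Γ × Γ)) :
    (d₂₁ (Rep.trivial ℤ Γ ℤ)).hom (surfaceChain l) =
      Finsupp.single 1 1 - Finsupp.single (WeakRep.commProd l) (1 : ℤ) := by
  induction l with
  | nil =>
    refine (map_zero (d₂₁ (Rep.trivial ℤ Γ ℤ)).hom).trans ?_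
    exact (sub_self (Finsupp.single (1 : Γ) (1 : ℤ))).symm
  | cons p l ih =>
    obtain ⟨a, b⟩ := p
    obtain ⟨D, hD⟩ : ∃ D : (Γ × Γ →₀ ℤ) →+ (Γ →₀ ℤ),
        ∀ x, D x = (d₂₁ (Rep.trivial ℤ Γ ℤ)).hom x :=
      ⟨(d₂₁ (Rep.trivial ℤ Γ ℤ)).hom.toAddMonoidHom, fun _ => rfl⟩
    have hs : ∀ (x y : Γ) (n : ℤ), D (Finsupp.single (x, y) n) =
        Finsupp.single y n - Finsupp.single (x * y) n + Finsupp.single x n := fun x y n =>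
      (hD _).trans (d₂₁_single_trivial x y n)
    rw [← hD] at ih ⊢
    rw [surfaceChain, map_add, map_add, map_sub, map_sub, ih, hs, hs, hs, hs]
    rw [show ⁅a, b⁆ * (b * a) = a * b by simp [commutatorElement_def],
      show WeakRep.commProd ((a, b) :: l) = ⁅a, b⁆ * WeakRep.commProd l from rfl]
    abel

theorem surfaceChain_mem_cycles₂ {l : List (Γ × Γ)} (hl : WeakRep.commProd l = 1) :
    surfaceChain l ∈ cycles₂ (Rep.trivial ℤ Γ ℤ) := by
  rw [cycles₂, LinearMap.mem_ker]
  refine (d₂₁_surfaceChain l).trans ?_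
  rw [hl]
  exact sub_self _

/-- Every 2-cycle of a surface group is homologous to a multiple of the surface chain. The
cocycle with values in the 2-chains modulo boundaries and multiples of the surface chain that
sends `(a, b)` to the class of `[a|b]` is a coboundary. -/
theorem IsStandardPresentation.cycles₂_le {g : ℕ} {a b : Fin g → Γ}
    (hab : IsStandardPresentation a b) :
    cycles₂ (Rep.trivial ℤ Γ ℤ) ≤ boundaries₂ (Rep.trivial ℤ Γ ℤ) ⊔
      Submodule.span ℤ {surfaceChain (List.ofFn fun i => (a i, b i))} := by
  intro Ψ hΨ
  let S : Submodule ℤ (Γ × Γ →₀ ℤ) := boundaries₂ (Rep.trivial ℤ Γ ℤ) ⊔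
      Submodule.span ℤ {surfaceChain (List.ofFn fun i => (a i, b i))}
  let β : Γ → Γ → Multiplicative ((Γ × Γ →₀ ℤ) ⧸ S) := fun x y =>
    Multiplicative.ofAdd (S.mkQ (Finsupp.single (x, y) 1))
  have hpair : ∀ Φ : Γ × Γ →₀ ℤ, pairing Φ β = Multiplicative.ofAdd (S.mkQ Φ) := fun Φ => by
    induction Φ using Finsupp.induction_linear with
    | zero => rw [pairing_zero, map_zero]; rfl
    | add f g hf hg => rw [pairing_add, map_add, hf, hg]; rfl
    | single p n =>
      obtain ⟨x, y⟩ := p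
      rw [pairing_single]
      change Multiplicative.ofAdd (n • S.mkQ (Finsupp.single (x, y) 1)) = _
      rw [← map_smul, Finsupp.smul_single, smul_eq_mul, mul_one]
  have hβ : IsCocycle₂ β := fun x y z => by
    have h : S.mkQ (Finsupp.single (y, z) 1 - Finsupp.single (x * y, z) 1 +
        Finsupp.single (x, y * z) 1 - Finsupp.single (x, y) 1) = 0 := by
      rw [Submodule.mkQ_apply, Submodule.Quotient.mk_eq_zero]
      refine Submodule.mem_sup_left ⟨Finsupp.single (x, y, z) (1 : ℤ), ?_⟩
      exact d₃₂_single (A := Rep.trivial ℤ Γ ℤ) (x, y, z) (1 : ℤ)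
    rw [map_sub, map_add, map_sub, sub_add_eq_add_sub, sub_sub, sub_eq_zero] at h
    exact congrArg Multiplicative.ofAdd h
  have h₀ : pairing (surfaceChain (List.ofFn fun i => (a i, b i))) β = 1 := by
    rw [hpair]
    refine congrArg Multiplicative.ofAdd ((Submodule.Quotient.mk_eq_zero _).mpr ?_)
    exact Submodule.mem_sup_right (Submodule.mem_span_singleton_self _)
  have h := pairing_of_isCoboundary₂ hΨ (hab.isCoboundary₂ hβ h₀)
  rw [hpair] at h
  exact (Submodule.Quotient.mk_eq_zero S).mp (Multiplicative.ofAdd.injective h)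

theorem IsStandardPresentation.isFundamentalCycle_surfaceChain {g : ℕ} {a b : Fin g → Γ}
    (hab : IsStandardPresentation a b) :
    IsFundamentalCycle (surfaceChain (List.ofFn fun i => (a i, b i))) := by
  refine ⟨surfaceChain_mem_cycles₂ hab.commProd_eq_one, eq_top_iff.mpr fun x _ => ?_⟩
  induction x using H2_induction_on with
  | h Ψ =>
    obtain ⟨Φ, hΦ, χ, hχ, hsum⟩ := Submodule.mem_sup.mp (hab.cycles₂_le Ψ.2)
    obtain ⟨n, rfl⟩ := Submodule.mem_span_singleton.mp hχ
    refine Submodule.mem_span_singleton.mpr ⟨n, ?_⟩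
    refine (LinearMap.map_smul (H2π (Rep.trivial ℤ Γ ℤ)).hom n _).symm.trans ?_
    refine ((H2π_eq_iff _ _).mpr ?_).symm
    change Ψ.1 - n • surfaceChain (List.ofFn fun i => (a i, b i)) ∈ _
    rwa [← hsum, add_sub_cancel_right]

/-- A fundamental cycle generates `H₂`, so the surface chain is homologous to a multiple of it;
trivial pairing with `Ψ` thus forces trivial pairing with the surface chain. -/
theorem IsStandardPresentation.isCoboundary₂_iff {g : ℕ} {a b : Fin g → Γ}
    (hab : IsStandardPresentation a b) {β : Γ → Γ → A} (hβ : IsCocycle₂ β) {Ψ : Γ × Γ →₀ ℤ}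
    (hΨ : IsFundamentalCycle Ψ) : IsCoboundary₂ β ↔ pairing Ψ β = 1 := by
  obtain ⟨hc, htop⟩ := hΨ
  refine ⟨pairing_of_isCoboundary₂ hc, fun h => hab.isCoboundary₂ hβ ?_⟩
  have h₀ := surfaceChain_mem_cycles₂ hab.commProd_eq_one
  obtain ⟨n, hn⟩ := Submodule.mem_span_singleton.mp (htop.ge (Submodule.mem_top
    (x := (H2π (Rep.trivial ℤ Γ ℤ)).hom ⟨_, h₀⟩)))
  have hn' := (LinearMap.map_smul (H2π (Rep.trivial ℤ Γ ℤ)).hom n _).trans hn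
  have hb := pairing_of_mem_boundaries₂ ((H2π_eq_iff _ _).mp hn') hβ
  have hb' : pairing (n • Ψ - surfaceChain (List.ofFn fun i => (a i, b i))) β = 1 := hb
  rw [pairing_sub, pairing_smul, h, one_zpow, one_div, inv_eq_one] at hb'
  exact hb'

end Homology

/-! ### The label of the categorified relation -/

section CategorifiedRelation

open TwoGroup Functor.LaxMonoidal Functor.OplaxMonoidal

variable {Γ G A : Type*} [Group Γ] [Group G] [CommGroup A]

namespace WeakRep

variable {α : NormalizedCocycle3 G A} {ρ : Γ →* G} (F : WeakRep α ρ)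

theorem isCocycle₂_cochain_div (F' : WeakRep α ρ) :
    IsCocycle₂ fun a b => F.cochain a b / F'.cochain a b := fun a b c => by
  have h := F.cochain_coboundary a b c
  have h' := F'.cochain_coboundary a b c
  rw [div_mul_div_comm, div_mul_div_comm, h, h', mul_div_mul_left_eq_div]

theorem label_μ (a b : Γ) : label (μ F.functor ⟨a⟩ ⟨b⟩) = (F.cochain a b)⁻¹ := by
  have h := congrArg label (Functor.Monoidal.μ_δ F.functor (⟨a⟩ : Discrete Γ) ⟨b⟩)
  rw [label_comp, label_id] at h
  exact eq_inv_of_mul_eq_one_left h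

theorem label_swap (a b : Γ) : label (F.swap a b) =
    (F.cochain a b / F.cochain b a / F.cochain ⁅a, b⁆ (b * a))⁻¹ := by
  simp only [swap, label_comp, label_tensorHom, label_homMk, label_whiskerLeft, label_μ, label_map]
  change 1 * 1 * ((F.cochain a b)⁻¹ * (1 * (F.cochain ⁅a, b⁆ (b * a) *
    (F.cochain b a * (1 * 1))))) = _
  simp only [one_mul, mul_one, div_eq_mul_inv, mul_inv, inv_inv, mul_assoc]
  rw [mul_comm (F.cochain b a)]

/-- The associators contribute a factor that involves `F` only through `ρ`, so it is common to all
lifts. -/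
theorem label_commHom (a b : Γ) : label (F.commHom a b) = label (F.swap a b) *
    (α ⁅ρ a, ρ b⁆ (ρ b * ρ a) (ρ a)⁻¹ * α ⁅ρ a, ρ b⁆ (ρ b * ρ a * (ρ a)⁻¹) (ρ b)⁻¹ *
      α (ρ b) (ρ a) (ρ a)⁻¹) := by
  simp only [commHom, cancel, label_comp, label_whiskerLeft, label_whiskerRight, label_associator,
    label_rightUnitor, label_homMk, F.obj_as, map_commutatorElement, tensorObj_as,
    mul_one, mul_assoc]

theorem label_commProdHom_cons (a b : Γ) (l : List (Γ × Γ)) :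
    label (F.commProdHom ((a, b) :: l)) =
      label (F.commHom a b) * label (F.commProdHom l) *
        (F.cochain ⁅a, b⁆ (commProd l))⁻¹ := by
  rw [← label_μ]
  rfl

/-- The categorified relation, up to a factor that only depends on the underlying homomorphism,
is the inverse of the pairing with the surface chain. -/
theorem label_commProdHom (F' : WeakRep α ρ) (l : List (Γ × Γ)) :
    label (F.commProdHom l) * label (η F.functor) * pairing (surfaceChain l) F.cochain =
      label (F'.commProdHom l) * label (η F'.functor) *
        pairing (surfaceChain l) F'.cochain := by
  induction l with
  | nil =>
    have h : ∀ F : WeakRep α ρ, label (ε F.functor) * label (η F.functor) = 1 := fun F => by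
      rw [← label_comp, Functor.Monoidal.ε_η, label_id]
    simp only [surfaceChain, pairing_zero]
    exact congrArg (· * (1 : A)) ((h F).trans (h F').symm)
  | cons p l ih =>
    obtain ⟨a, b⟩ := p
    have h : ∀ F : WeakRep α ρ,
        label (F.commProdHom ((a, b) :: l)) * label (η F.functor) *
          pairing (surfaceChain ((a, b) :: l)) F.cochain =
        (α ⁅ρ a, ρ b⁆ (ρ b * ρ a) (ρ a)⁻¹ * α ⁅ρ a, ρ b⁆ (ρ b * ρ a * (ρ a)⁻¹) (ρ b)⁻¹ *
          α (ρ b) (ρ a) (ρ a)⁻¹) *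
          (label (F.commProdHom l) * label (η F.functor) *
            pairing (surfaceChain l) F.cochain) := fun F => by
      rw [pairing_surfaceChain_cons, label_commProdHom_cons, label_commHom, label_swap]
      apply Additive.ofMul.injective
      simp only [ofMul_mul, ofMul_div, ofMul_inv]
      abel
    rw [h, h, ih]

theorem label_categorifiedRelation (l : List (Γ × Γ)) (hl : commProd l = 1) :
    label (F.categorifiedRelation l hl) = label (F.commProdHom l) * label (η F.functor) := by
  rw [categorifiedRelation, label_comp, label_comp, label_map, one_mul]

theorem label_categorifiedRelation_mul_pairing (F' : WeakRep α ρ) (l : List (Γ × Γ))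
    (hl : commProd l = 1) :
    label (F.categorifiedRelation l hl) * pairing (surfaceChain l) F.cochain =
      label (F'.categorifiedRelation l hl) * pairing (surfaceChain l) F'.cochain := by
  rw [label_categorifiedRelation, label_categorifiedRelation, F.label_commProdHom F']

theorem categorifiedRelation_eq_iff (F' : WeakRep α ρ) (l : List (Γ × Γ))
    (hl : commProd l = 1) :
    F.categorifiedRelation l hl = F'.categorifiedRelation l hl ↔
      pairing (surfaceChain l) F.cochain = pairing (surfaceChain l) F'.cochain := by
  have h := F.label_categorifiedRelation_mul_pairing F' l hl
  constructor
  · intro h'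
    rw [h'] at h
    exact mul_left_cancel h
  · intro h'
    rw [h'] at h
    exact hom_ext (mul_right_cancel h)

end WeakRep

end CategorifiedRelation

/-! ### Local sections of submersions -/

section LocalSections

/-- A submersion has a continuous local section through every point. -/
theorem exists_local_section {m d : ℕ} {M X : Type*} [TopologicalSpace M]
    [ChartedSpace (EuclideanSpace ℝ (Fin m)) M] [TopologicalSpace X]
    [ChartedSpace (EuclideanSpace ℝ (Fin d)) X] {f : M → X}
    (hf : Manifold.IsSubmersion (𝓡 m) (𝓡 d) ∞ f) (z : M) :
    ∃ (W : Set X) (s : X → M), IsOpen W ∧ f z ∈ W ∧ ContinuousOn s W ∧ ∀ x ∈ W, f (s x) = x := by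
  obtain ⟨F, _, _, h⟩ := hf.isSubmersionAt z
  let φ := h.domChart.extend (𝓡 m)
  let ψ := h.codChart.extend (𝓡 d)
  -- In the charts `f` is the first projection of a product; the section keeps the second coordinate
  -- fixed at its value for `z`.
  let q : X → EuclideanSpace ℝ (Fin m) := fun x => h.equiv.symm (ψ x, (h.equiv (φ z)).2)
  have hφ : IsOpen φ.target := h.domChart.isOpen_extend_target
  have hq : ContinuousOn q h.codChart.source :=
    h.equiv.symm.continuous.comp_continuousOn
      ((h.codChart.continuousOn_extend.mono (by simp)).prodMk continuousOn_const)
  have hfst : ∀ v ∈ φ.target, ψ (f (φ.symm v)) = (h.equiv v).1 := fun v hv => h.writtenInCharts hv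
  have hzs : z ∈ φ.source := by
    rw [OpenPartialHomeomorph.extend_source]; exact h.mem_domChart_source
  have hqz : q (f z) = φ z := by
    have := hfst _ (φ.map_source hzs)
    rw [φ.left_inv hzs] at this
    simp [q, this]
  refine ⟨h.codChart.source ∩ q ⁻¹' φ.target, φ.symm ∘ q,
    hq.isOpen_inter_preimage h.codChart.open_source hφ, ⟨h.mem_codChart_source, ?_⟩, ?_, ?_⟩
  · rw [Set.mem_preimage, hqz]
    exact φ.map_source hzs
  · exact (h.domChart.continuousOn_extend_symm).comp (hq.mono Set.inter_subset_left)
      fun x hx => hx.2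
  · rintro x ⟨hx, hxq⟩
    have h₁ := hfst _ hxq
    have h₂ : f (φ.symm (q x)) ∈ ψ.source := by
      rw [OpenPartialHomeomorph.extend_source]
      apply h.source_subset_preimage_source
      have := φ.map_target hxq
      rwa [OpenPartialHomeomorph.extend_source] at this
    refine ψ.injOn h₂ (by rwa [OpenPartialHomeomorph.extend_source]) ?_
    rw [h₁]
    simp [q]

end LocalSections

/-! ### Locally constant 1-cocycles on simply connected spaces -/

section LocallyConstantCocycle

open Filter Topology

/-- A locally constant 1-cocycle on a simply connected space is a coboundary. -/
theorem exists_trivialization_of_locallyConstant_cocycle {B A ι : Type*} [TopologicalSpace B]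
    [SimplyConnectedSpace B] [LocallyPathConnectedSpace B] [CommGroup A] (W : ι → Set B)
    (hW : ∀ i, IsOpen (W i)) (hcover : ∀ x, ∃ i, x ∈ W i) (c : ι → ι → B → A)
    (hc : ∀ i j k x, x ∈ W i → x ∈ W j → x ∈ W k → c i j x * c j k x = c i k x)
    (hloc : ∀ i j x, x ∈ W i → x ∈ W j → ∀ᶠ y in 𝓝 x, c i j y = c i j x) :
    ∃ f : ι → B → A, (∀ i, ∀ x ∈ W i, ∀ᶠ y in 𝓝 x, f i y = f i x) ∧
      ∀ i j x, x ∈ W i → x ∈ W j → f j x = c i j x * f i x := by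
  let _ : TopologicalSpace A := ⊥
  have : DiscreteTopology A := ⟨rfl⟩
  have hself : ∀ i x, x ∈ W i → c i i x = 1 := fun i x hx => mul_eq_left.mp (hc i i i x hx hx hx)
  choose idx hidx using hcover
  -- The cocycle glues copies of the discrete space `A` to a covering of `B`.
  let Z : FiberBundleCore ι B A :=
    { baseSet := W
      isOpen_baseSet := hW
      indexAt := idx
      mem_baseSet_at := hidx
      coordChange := fun i j x a => c i j x * a
      coordChange_self := fun i x hx a => by rw [hself i x hx, one_mul]
      continuousOn_coordChange := fun i j => by
        rintro ⟨x, a⟩ ⟨⟨hxi, hxj⟩, -⟩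
        refine ContinuousAt.continuousWithinAt ?_
        refine (continuousAt_const (y := c i j x * a)).congr ?_
        have h₁ := (hloc i j x hxi hxj).prod_inl_nhds a
        have h₂ : ∀ᶠ b in 𝓝 a, b = a := by
          rw [nhds_discrete]
          exact eventually_pure.mpr rfl
        filter_upwards [h₁, h₂.prod_inr_nhds x] with p hp hp'
        rw [hp, hp']
      coordChange_comp := fun i j k x hx a => by
        rw [← mul_assoc, mul_comm (c j k x), hc i j k x hx.1.1 hx.1.2 hx.2] }
  have hcov : IsCoveringMap (Bundle.TotalSpace.proj : Z.TotalSpace → B) :=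
    FiberBundle.isCoveringMap (F := A) (E := Z.Fiber)
  obtain ⟨x₀⟩ : Nonempty B := inferInstance
  -- Simple connectedness lifts the identity of `B` to a global section; its coordinates in the
  -- local trivializations are the required functions.
  obtain ⟨s, ⟨-, hs⟩, -⟩ := hcov.existsUnique_continuousMap_lifts (ContinuousMap.id B) x₀
    (⟨x₀, (1 : A)⟩ : Z.TotalSpace) rfl
  have hs' : ∀ x, (s x).proj = x := fun x => congrFun hs x
  refine ⟨fun i x => ((Z.localTriv i) (s x)).2, fun i x hx => ?_, fun i j x hi hj => ?_⟩
  · have h₁ : ContinuousAt (fun y => ((Z.localTriv i) (s y)).2) x := by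
      refine continuous_snd.continuousAt.comp
        (((Z.localTriv i).continuousAt ?_).comp s.continuous.continuousAt)
      rw [Bundle.Trivialization.mem_source]
      change (s x).proj ∈ W i
      rwa [hs' x]
    have h₂ := h₁.tendsto
    rw [nhds_discrete A] at h₂
    exact tendsto_pure.mp h₂
  · have e : ∀ k, ((Z.localTriv k) (s x)).2 = c (idx (s x).proj) k (s x).proj * (show A from (s x).2) :=
      fun k => rfl
    dsimp only
    rw [e, e, hs' x, ← hc (idx x) i j x (hidx x) hi hj]
    rw [mul_left_comm, mul_assoc]

end LocallyConstantCocycle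

/-! ### Fibres of the universal covering and the fundamental group -/

section DeckTransformations

namespace UniversalCover

variable {d : ℕ} {X : Type*} [TopologicalSpace X] [ChartedSpace (EuclideanSpace ℝ (Fin d)) X]
  (U : UniversalCover d X)

theorem locallyPathConnectedSpace_Y : LocallyPathConnectedSpace U.Y :=
  ChartedSpace.locallyPathConnectedSpace (EuclideanSpace ℝ (Fin U.dim)) U.Y

/-- The deck transformation that maps `y₁` to `y₂`. -/
theorem exists_deck {y₁ y₂ : U.Y} (h : U.proj y₁ = U.proj y₂) :
    ∃ τ : C(U.Y, U.Y), (∀ y, U.proj y = U.proj (τ y)) ∧ τ y₁ = y₂ := by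
  have := U.locallyPathConnectedSpace_Y
  obtain ⟨τ, ⟨h₁, h₂⟩, -⟩ := U.isCoveringMap.existsUnique_continuousMap_lifts
    ⟨U.proj, U.isCoveringMap.continuous⟩ y₁ y₂ h.symm
  exact ⟨τ, fun y => (congrFun h₂ y).symm, h₁⟩

/-- Deck transformations are determined by elements of the fundamental group. -/
theorem diff_deck {τ : C(U.Y, U.Y)} (hτ : ∀ y, U.proj y = U.proj (τ y)) (y y' : U.Y) :
    U.diff y (τ y) (hτ y) = U.diff y' (τ y') (hτ y') := by
  have hc : Continuous fun y : U.Y => (⟨(y, τ y), hτ y⟩ : U.toCover.Fib₂) := by fun_prop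
  exact (U.diff_isLocallyConstant.comp_continuous hc).apply_eq_of_isPreconnected
    isPreconnected_univ (Set.mem_univ _) (Set.mem_univ _)

theorem loopOf_eq {y₁ y₂ : U.Y} (h : U.proj y₁ = U.proj y₂) (p₁ : Path U.base y₁)
    (p₂ : Path U.base y₂) :
    U.loopOf h p₁ p₂ =
      (((Path.Homotopic.Quotient.mk p₂).map ⟨U.proj, U.isCoveringMap.continuous⟩).cast rfl h).trans
        ((Path.Homotopic.Quotient.mk p₁).map ⟨U.proj, U.isCoveringMap.continuous⟩).symm := rfl

theorem exists_diff_eq (y : U.Y) (a : U.Pi1) :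
    ∃ (y' : U.Y) (h : U.proj y = U.proj y'), U.diff y y' h = a := by
  let p := PathConnectedSpace.somePath U.base y
  let q := (Path.Homotopic.Quotient.mk p).map ⟨U.proj, U.isCoveringMap.continuous⟩
  -- The point `y · a` is the endpoint of the lift from the base point of `a` followed by the
  -- projected path to `y`.
  let γ : Path.Homotopic.Quotient (U.proj U.base) (U.proj y) :=
    Path.Homotopic.Quotient.trans a q
  let e := U.isCoveringMap.monodromy γ ⟨U.base, rfl⟩
  have hγ := U.isCoveringMap.map_liftPathQuotient γ ⟨U.base, rfl⟩
  obtain ⟨p', hp'⟩ := Path.Homotopic.Quotient.mk_surjective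
    (U.isCoveringMap.liftPathQuotient γ ⟨U.base, rfl⟩)
  have he : U.proj y = U.proj e.1 := e.2.symm
  refine ⟨e.1, he, ?_⟩
  rw [U.diff_eq he p p', loopOf_eq, hp', hγ]
  have hcast : (γ.cast rfl e.2).cast rfl he = γ :=
    (γ.cast_cast rfl e.2 rfl he).trans γ.cast_rfl_rfl
  refine (congrArg (Path.Homotopic.Quotient.trans · q.symm) hcast).trans ?_
  rw [Path.Homotopic.Quotient.trans_assoc, Path.Homotopic.Quotient.trans_symm]
  exact Path.Homotopic.Quotient.trans_refl _

/-- Cancelling the path to `y₁` shows that the projected paths to `y₂` and `y₃` are homotopic, and a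
point of the covering is the endpoint of the lift of its projected path. -/
theorem eq_of_diff_eq {y₁ y₂ y₃ : U.Y} (h₂ : U.proj y₁ = U.proj y₂) (h₃ : U.proj y₁ = U.proj y₃)
    (h : U.diff y₁ y₂ h₂ = U.diff y₁ y₃ h₃) : y₂ = y₃ := by
  let p := PathConnectedSpace.somePath U.base
  let q : ∀ y, Path.Homotopic.Quotient (U.proj U.base) (U.proj y) := fun y =>
    (Path.Homotopic.Quotient.mk (p y)).map ⟨U.proj, U.isCoveringMap.continuous⟩
  have hq : (q y₂).cast rfl h₂ = (q y₃).cast rfl h₃ := by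
    rw [U.diff_eq h₂ (p _) (p _), U.diff_eq h₃ (p _) (p _), loopOf_eq, loopOf_eq] at h
    have h' := congrArg (Path.Homotopic.Quotient.trans · (q y₁)) h
    simpa only [Path.Homotopic.Quotient.trans_assoc, Path.Homotopic.Quotient.symm_trans,
      Path.Homotopic.Quotient.trans_refl, q] using h'
  have key : ∀ (y : U.Y) (hy : U.proj y₁ = U.proj y),
      U.isCoveringMap.monodromy ((q y).cast rfl hy) ⟨U.base, rfl⟩ = ⟨y, hy.symm⟩ := fun y hy =>
    U.isCoveringMap.monodromy_eq_of_map_eq (Path.Homotopic.Quotient.mk (p y)) rfl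
  exact congrArg Subtype.val ((key y₂ h₂).symm.trans ((congrArg (fun γ =>
    U.isCoveringMap.monodromy γ ⟨U.base, rfl⟩) hq).trans (key y₃ h₃)))

end UniversalCover

end DeckTransformations

/-! ### Descent from Čech cocycles to group cocycles -/

section Descent

open Filter Topology

variable {d : ℕ} {X : Type*} [TopologicalSpace X] [ChartedSpace (EuclideanSpace ℝ (Fin d)) X]

/-- The extension by `1` of a function on `Y ×_X Y` to all pairs of points of `Y`. -/
noncomputable def Cover.extendOne {A : Type*} [One A] (c : Cover d X) (F : c.Fib₂ → A)
    (y₁ y₂ : c.Y) : A :=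
  open scoped Classical in if h : c.proj y₁ = c.proj y₂ then F (c.mk₂ y₁ y₂ h) else 1

theorem Cover.extendOne_apply {A : Type*} [One A] (c : Cover d X) (F : c.Fib₂ → A)
    {y₁ y₂ : c.Y} (h : c.proj y₁ = c.proj y₂) : c.extendOne F y₁ y₂ = F (c.mk₂ y₁ y₂ h) :=
  dif_pos h

theorem Cover.eventually_extendOne_eq {A B : Type*} [One A] [TopologicalSpace B] (c : Cover d X)
    {F : c.Fib₂ → A} (hF : IsLocallyConstant F) {f₁ f₂ : B → c.Y} {x : B}
    (h₁ : ContinuousAt f₁ x) (h₂ : ContinuousAt f₂ x)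
    (h : ∀ᶠ y in 𝓝 x, c.proj (f₁ y) = c.proj (f₂ y)) :
    ∀ᶠ y in 𝓝 x, c.extendOne F (f₁ y) (f₂ y) = c.extendOne F (f₁ x) (f₂ x) := by
  have hx := h.self_of_nhds
  obtain ⟨O, hO, hOF⟩ := isOpen_induced_iff.mp
    (hF.isOpen_fiber (F (c.mk₂ (f₁ x) (f₂ x) hx)))
  have hmem : ∀ p : c.Fib₂, p.1 ∈ O ↔ F p = F (c.mk₂ (f₁ x) (f₂ x) hx) := fun p =>
    Set.ext_iff.mp hOF p
  filter_upwards [h, (h₁.prodMk h₂).preimage_mem_nhds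
    (hO.mem_nhds ((hmem (c.mk₂ (f₁ x) (f₂ x) hx)).mpr rfl))] with y hy hyO
  rw [c.extendOne_apply F hy, c.extendOne_apply F hx]
  exact (hmem (c.mk₂ (f₁ y) (f₂ y) hy)).mp hyO

namespace UniversalCover

variable (U : UniversalCover d X) {A : Type*} [CommGroup A]

/-- A 2-cocycle of the fundamental group is a coboundary if it becomes the coboundary of a
locally constant function on a cover: its class is not lost in the Čech cohomology of the base,
as the universal covering is simply connected. -/
theorem isCoboundary₂_of_cover {β : U.Pi1 → U.Pi1 → A} (hβ : IsCocycle₂ β) (Z : Cover d X)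
    {v : Z.Y → U.Y} (hv : Continuous v) (hpv : ∀ z, U.proj (v z) = Z.proj z) {η : Z.Fib₂ → A}
    (hη : IsLocallyConstant η)
    (hηβ : ∀ (z₁ z₂ z₃ : Z.Y) (h₁₂ : Z.proj z₁ = Z.proj z₂) (h₂₃ : Z.proj z₂ = Z.proj z₃),
      η (Z.mk₂ z₂ z₃ h₂₃) * η (Z.mk₂ z₁ z₂ h₁₂) / η (Z.mk₂ z₁ z₃ (h₁₂.trans h₂₃)) =
        β (U.diff (v z₁) (v z₂) (by rw [hpv, hpv, h₁₂]))
          (U.diff (v z₂) (v z₃) (by rw [hpv, hpv, h₂₃]))) :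
    IsCoboundary₂ β := by
  have := U.locallyPathConnectedSpace_Y
  let D : U.Y → U.Y → U.Pi1 := U.toCover.extendOne fun p => U.diff p.1.1 p.1.2 p.2
  let E : Z.Y → Z.Y → A := Z.extendOne η
  have hDdiff : ∀ {y₁ y₂} (h : U.proj y₁ = U.proj y₂), D y₁ y₂ = U.diff y₁ y₂ h := fun h =>
    U.toCover.extendOne_apply _ h
  have hD : ∀ {y₁ y₂ y₃}, U.proj y₁ = U.proj y₂ → U.proj y₂ = U.proj y₃ →
      D y₁ y₃ = D y₁ y₂ * D y₂ y₃ := fun {y₁ y₂ y₃} h h' => by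
    rw [hDdiff h, hDdiff h', hDdiff (h.trans h')]
    exact U.diff_mul y₁ y₂ y₃ h h'
  have hE : ∀ {z₁ z₂ z₃}, Z.proj z₁ = Z.proj z₂ → Z.proj z₂ = Z.proj z₃ →
      E z₂ z₃ * E z₁ z₂ / E z₁ z₃ = β (D (v z₁) (v z₂)) (D (v z₂) (v z₃)) :=
    fun {z₁ z₂ z₃} h h' => by
      rw [hDdiff (by rw [hpv, hpv, h]), hDdiff (by rw [hpv, hpv, h']), ← hηβ z₁ z₂ z₃ h h']
      simp only [E, Z.extendOne_apply η h, Z.extendOne_apply η h',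
        Z.extendOne_apply η (h.trans h')]
  have hsec : ∀ x : X, ∃ (W : Set X) (s : X → Z.Y), IsOpen W ∧ x ∈ W ∧ ContinuousOn s W ∧
      ∀ x ∈ W, Z.proj (s x) = x := fun x => by
    obtain ⟨z, rfl⟩ := Z.surjective x
    exact exists_local_section Z.isSubmersion z
  choose W s hWo hxW hs hps using hsec
  have hπ : Continuous U.proj := U.isCoveringMap.continuous
  -- Local sections of `Z`, pulled back to the universal covering; they are constant on the fibres
  -- of the covering.
  let σ : X → U.Y → Z.Y := fun i y => s i (U.proj y)
  have hσW : ∀ {i y}, U.proj y ∈ W i → ∀ᶠ y' in 𝓝 y, U.proj y' ∈ W i := fun {i y} hy =>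
    hπ.continuousAt.preimage_mem_nhds ((hWo i).mem_nhds hy)
  have hσ : ∀ {i y}, U.proj y ∈ W i → ContinuousAt (σ i) y := fun {i y} hy =>
    ContinuousAt.comp (f := U.proj) (g := s i) ((hs i).continuousAt ((hWo i).mem_nhds hy))
      hπ.continuousAt
  have hpσ : ∀ {i y}, U.proj y ∈ W i → Z.proj (σ i y) = U.proj y := fun {i y} hy => hps i _ hy
  have hpvσ : ∀ {i y}, U.proj y ∈ W i → U.proj (v (σ i y)) = U.proj y := fun {i y} hy =>
    (hpv _).trans (hpσ hy)
  have hevD : ∀ {f₁ f₂ : U.Y → U.Y} {y}, ContinuousAt f₁ y → ContinuousAt f₂ y →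
      (∀ᶠ y' in 𝓝 y, U.proj (f₁ y') = U.proj (f₂ y')) →
      ∀ᶠ y' in 𝓝 y, D (f₁ y') (f₂ y') = D (f₁ y) (f₂ y) := fun h₁ h₂ h =>
    U.toCover.eventually_extendOne_eq U.diff_isLocallyConstant h₁ h₂ h
  -- On the universal covering the point `y` itself is an extra vertex in the fibre, and coning off
  -- with it writes `β` as a coboundary. Dividing `η` by this cone leaves a locally constant
  -- 1-cocycle.
  let c : X → X → U.Y → A := fun i j y =>
    E (σ i y) (σ j y) / β (D y (v (σ i y))) (D (v (σ i y)) (v (σ j y)))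
  obtain ⟨f, hf, hfc⟩ := exists_trivialization_of_locallyConstant_cocycle
    (fun i => U.proj ⁻¹' W i) (fun i => (hWo i).preimage hπ) (fun y => ⟨U.proj y, hxW _⟩) c
    (fun i j k y hi hj hk => by
      have h₁ := hE ((hpσ hi).trans (hpσ hj).symm) ((hpσ hj).trans (hpσ hk).symm)
      have h₂ := hβ (D y (v (σ i y))) (D (v (σ i y)) (v (σ j y))) (D (v (σ j y)) (v (σ k y)))
      rw [← hD (hpvσ hi).symm ((hpvσ hi).trans (hpvσ hj).symm),
        ← hD ((hpvσ hi).trans (hpvσ hj).symm) ((hpvσ hj).trans (hpvσ hk).symm)] at h₂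
      replace h₁ := congrArg Additive.ofMul h₁
      replace h₂ := congrArg Additive.ofMul h₂
      apply Additive.ofMul.injective
      simp only [c, ofMul_mul, ofMul_div] at h₁ h₂ ⊢
      linear_combination (norm := abel) h₁ + h₂)
    (fun i j y hi hj => by
      have hi' := hv.continuousAt.comp (hσ hi)
      have hj' := hv.continuousAt.comp (hσ hj)
      filter_upwards [hevD continuousAt_id hi' ((hσW hi).mono fun y' hy' => (hpvσ hy').symm),
        hevD hi' hj' (((hσW hi).and (hσW hj)).mono fun y' hy' =>
          (hpvσ hy'.1).trans (hpvσ hy'.2).symm),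
        Z.eventually_extendOne_eq hη (hσ hi) (hσ hj) (((hσW hi).and (hσW hj)).mono fun y' hy' =>
          (hpσ hy'.1).trans (hpσ hy'.2).symm)] with y' h₁ h₂ h₃
      exact congrArg₂ (· / ·) h₃ (congrArg₂ β h₁ h₂))
  -- The candidate primitive on pairs of points in a fibre: the mismatch of the two cones with
  -- vertices `y₁` and `y₂`, corrected by the trivialization `f`. The corrections make it
  -- independent of the index `i`, which is `hKind`.
  let K : X → U.Y → U.Y → A := fun i y₁ y₂ =>
    β (D y₁ y₂) (D y₂ (v (σ i y₂))) * f i y₁ / f i y₂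
  have hKind : ∀ {i j y₁ y₂}, U.proj y₁ = U.proj y₂ → U.proj y₂ ∈ W i → U.proj y₂ ∈ W j →
      K i y₁ y₂ = K j y₁ y₂ := fun {i j y₁ y₂} h hi hj => by
    have h₁ := hfc i j y₁ (by rwa [Set.mem_preimage, h]) (by rwa [Set.mem_preimage, h])
    have h₂ := hfc i j y₂ hi hj
    have hσ₁ : ∀ i, σ i y₁ = σ i y₂ := fun i => congrArg (s i) h
    have h₃ := hβ (D y₁ y₂) (D y₂ (v (σ i y₂))) (D (v (σ i y₂)) (v (σ j y₂)))
    rw [← hD (hpvσ hi).symm ((hpvσ hi).trans (hpvσ hj).symm), ← hD h (hpvσ hi).symm] at h₃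
    simp only [c, hσ₁] at h₁ h₂
    replace h₁ := congrArg Additive.ofMul h₁
    replace h₂ := congrArg Additive.ofMul h₂
    replace h₃ := congrArg Additive.ofMul h₃
    apply Additive.ofMul.injective
    simp only [K, ofMul_mul, ofMul_div] at h₁ h₂ h₃ ⊢
    linear_combination (norm := abel) h₂ - h₁ - h₃
  choose pt hpt hdpt using U.exists_diff_eq U.base
  let κ : U.Pi1 → A := fun a => K (U.proj U.base) U.base (pt a)
  -- `K` depends on the pair only through the group element. Along the graph of the deck
  -- transformation `τ` it is locally constant, because near each point the index can be kept fixed,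
  -- hence constant as the covering space is connected.
  have hκ : ∀ {i y₁ y₂}, U.proj y₁ = U.proj y₂ → U.proj y₂ ∈ W i →
      K i y₁ y₂ = κ (D y₁ y₂) := fun {i y₁ y₂} h hi => by
    obtain ⟨τ, hτ, hτb⟩ := U.exists_deck (hpt (D y₁ y₂))
    have hDτ : ∀ y, D y (τ y) = D y₁ y₂ := fun y => by
      rw [hDdiff (hτ y), U.diff_deck hτ y U.base, ← hdpt (D y₁ y₂)]
      simp only [hτb]
    have hτy : τ y₁ = y₂ := U.eq_of_diff_eq (hτ y₁) h (by rw [← hDdiff, ← hDdiff, hDτ])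
    have hloc : IsLocallyConstant fun y => K (U.proj y) y (τ y) := by
      rw [IsLocallyConstant.iff_eventually_eq]
      intro y
      have hτW : U.proj (τ y) ∈ W (U.proj y) := by rw [← hτ y]; exact hxW _
      have hτc := τ.continuous.continuousAt (x := y)
      filter_upwards [hσW (hxW (U.proj y)), hf (U.proj y) y (hxW _),
        hτc.eventually (hf (U.proj y) (τ y) hτW),
        hτc.eventually (hevD continuousAt_id (hv.continuousAt.comp (hσ hτW))
          ((hσW hτW).mono fun y' hy' => (hpvσ hy').symm))] with y' h₁ h₂ h₃ h₄
      rw [hKind (j := U.proj y) (hτ y') (by rw [← hτ y']; exact hxW _) (by rwa [← hτ y'])]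
      simp only [K, hDτ, h₂, h₃]
      congr 3
    have h₁ := hloc.apply_eq_of_isPreconnected isPreconnected_univ (Set.mem_univ y₁)
      (Set.mem_univ U.base)
    rw [hτy, hτb] at h₁
    exact (hKind h hi (by rw [← h]; exact hxW _)).trans h₁
  refine ⟨κ, fun a b => ?_⟩
  obtain ⟨y₂, h₂, rfl⟩ := U.exists_diff_eq U.base a
  obtain ⟨y₃, h₃, rfl⟩ := U.exists_diff_eq y₂ b
  have hW₂ : U.proj y₂ ∈ W (U.proj U.base) := by rw [← h₂]; exact hxW _
  have hW₃ : U.proj y₃ ∈ W (U.proj U.base) := by rwa [← h₃]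
  have hσ₃ : σ (U.proj U.base) y₂ = σ (U.proj U.base) y₃ := congrArg (s _) h₃
  -- With all three values of `κ` taken at one index, the factors `f` cancel and the cocycle
  -- identity for `β` remains.
  rw [← hDdiff, ← hDdiff, ← hD h₂ h₃, ← hκ h₂ hW₂, ← hκ h₃ hW₃, ← hκ (h₂.trans h₃) hW₃]
  have h := hβ (D U.base y₂) (D y₂ y₃) (D y₃ (v (σ (U.proj U.base) y₃)))
  rw [← hD h₂ h₃, ← hD h₃ (hpvσ hW₃).symm] at h
  replace h := congrArg Additive.ofMul h
  apply Additive.ofMul.injective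
  simp only [K, hσ₃, ofMul_mul, ofMul_div] at h ⊢
  linear_combination (norm := abel) -h

end UniversalCover

end Descent

/-! ### Isomorphism of bundles as a coboundary condition -/

section Classification

variable {d : ℕ} {X : Type*} [TopologicalSpace X] [ChartedSpace (EuclideanSpace ℝ (Fin d)) X]
  {G A : Type*} [Group G] [CommGroup A]

/-- Any lift trivializes `ρ^* α`. Expanding the three values of `α` by `cochain_coboundary` leaves a
Čech coboundary in the mixed terms and a comparison of the values at `s` and at `r`. -/
theorem WeakRep.associator_ratio {Γ : Type*} [Group Γ] {α : NormalizedCocycle3 G A} {ρ : Γ →* G}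
    (F : WeakRep α ρ) {k₁ k₂ k₃ r₁₂ r₂₃ s₁₂ s₂₃ : Γ} (h₁₂ : s₁₂ * k₂ = k₁ * r₁₂)
    (h₂₃ : s₂₃ * k₃ = k₂ * r₂₃) :
    α (ρ s₁₂) (ρ k₂) (ρ r₂₃) /
        (α (ρ k₁) (ρ r₁₂) (ρ r₂₃) * α (ρ s₁₂) (ρ s₂₃) (ρ k₃)) =
      (F.cochain k₁ r₁₂ / F.cochain s₁₂ k₂) * (F.cochain k₂ r₂₃ / F.cochain s₂₃ k₃) /
        (F.cochain k₁ (r₁₂ * r₂₃) / F.cochain (s₁₂ * s₂₃) k₃) *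
          (F.cochain s₁₂ s₂₃ / F.cochain r₁₂ r₂₃) := by
  have h₁ := congrArg Additive.ofMul (F.cochain_coboundary s₁₂ k₂ r₂₃)
  have h₂ := congrArg Additive.ofMul (F.cochain_coboundary k₁ r₁₂ r₂₃)
  have h₃ := congrArg Additive.ofMul (F.cochain_coboundary s₁₂ s₂₃ k₃)
  rw [h₁₂, ← h₂₃] at h₁
  apply Additive.ofMul.injective
  simp only [ofMul_mul, ofMul_div] at h₁ h₂ h₃ ⊢
  linear_combination (norm := abel) h₂ + h₃ - h₁

namespace UniversalCover

variable (U : UniversalCover d X) {α : NormalizedCocycle3 G A} {ρ : U.Pi1 →* G}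

/-- If `(y, g)` and `(y', g')` represent the same point of the `G`-bundle of `ρ`, then
`g' = ρ(y', y) g`. -/
theorem mkPoint_eq {y y' : U.Y} {g g' : G}
    (h : (U.cechCocycle ρ).mkPoint y g = (U.cechCocycle ρ).mkPoint y' g')
    (hy : U.proj y' = U.proj y) : g' = ρ (U.diff y' y hy) * g := by
  classical
  -- The fibre coordinate relative to `y'`, with the junk value `1` over other points of the base.
  let e : (U.cechCocycle ρ).TotalSpace → G :=
    Quot.lift (fun p => if hp : U.proj y' = U.proj p.1 then ρ (U.diff y' p.1 hp) * p.2 else 1) (by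
      rintro ⟨y₁, g₁⟩ ⟨y₂, g₂⟩ ⟨h₁₂, hg⟩
      change U.proj y₁ = U.proj y₂ at h₁₂
      change g₁ = ρ (U.diff y₁ y₂ h₁₂) * g₂ at hg
      by_cases hy₁ : U.proj y' = U.proj y₁
      · dsimp only
        rw [dif_pos hy₁, dif_pos (hy₁.trans h₁₂), hg, U.diff_mul y' y₁ y₂ hy₁ h₁₂, map_mul, mul_assoc]
      · dsimp only
        rw [dif_neg hy₁, dif_neg fun hy₂ => hy₁ (hy₂.trans h₁₂.symm)])
  have he : ∀ y₁ g₁ (h₁ : U.proj y' = U.proj y₁),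
      e ((U.cechCocycle ρ).mkPoint y₁ g₁) = ρ (U.diff y' y₁ h₁) * g₁ := fun y₁ g₁ h₁ => dif_pos h₁
  rw [← he y g hy, h, he y' g' rfl, U.diff_self, map_one, one_mul]

theorem isLocallyConstant_diff_comp {B : Type*} [TopologicalSpace B] {f₁ f₂ : B → U.Y}
    (h₁ : Continuous f₁) (h₂ : Continuous f₂) (h : ∀ x, U.proj (f₁ x) = U.proj (f₂ x)) :
    IsLocallyConstant fun x => U.diff (f₁ x) (f₂ x) (h x) := by
  have hc : Continuous fun x => (⟨(f₁ x, f₂ x), h x⟩ : U.toCover.Fib₂) :=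
    (h₁.prodMk h₂).subtype_mk _
  have := U.diff_isLocallyConstant.comp_continuous hc
  exact this

/-- The coherence equation of a 1-morphism that covers the identity exhibits the quotient of the
cochains of two weak representations as the coboundary of a locally constant function. -/
theorem isCoboundary₂_of_coherence {F F' : WeakRep α ρ} (Z : Cover d X) {v₁ v₂ : Z.Y → U.Y}
    (hv₁ : Continuous v₁) (hv₂ : Continuous v₂) (hpv₁ : ∀ z, U.proj (v₁ z) = Z.proj z)
    (hp : ∀ z, U.proj (v₂ z) = U.proj (v₁ z))
    (hp₁ : ∀ {z z'}, Z.proj z = Z.proj z' → U.proj (v₁ z) = U.proj (v₁ z'))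
    (hp₂ : ∀ {z z'}, Z.proj z = Z.proj z' → U.proj (v₂ z) = U.proj (v₂ z'))
    {η : Z.Fib₂ → A} (hηl : IsLocallyConstant η)
    (hη : ∀ (z₁ z₂ z₃ : Z.Y) (h₁₂ : Z.proj z₁ = Z.proj z₂) (h₂₃ : Z.proj z₂ = Z.proj z₃),
      η (Z.mk₂ z₂ z₃ h₂₃) * η (Z.mk₂ z₁ z₂ h₁₂) / η (Z.mk₂ z₁ z₃ (h₁₂.trans h₂₃)) =
        F.cochain (U.diff (v₁ z₁) (v₁ z₂) (hp₁ h₁₂)) (U.diff (v₁ z₂) (v₁ z₃) (hp₁ h₂₃)) /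
            F.cochain 1 1 /
          (F'.cochain (U.diff (v₂ z₁) (v₂ z₂) (hp₂ h₁₂)) (U.diff (v₂ z₂) (v₂ z₃) (hp₂ h₂₃)) /
            F'.cochain 1 1) *
          (α (ρ (U.diff (v₂ z₁) (v₂ z₂) (hp₂ h₁₂))) (ρ (U.diff (v₂ z₂) (v₁ z₂) (hp z₂)))
              (ρ (U.diff (v₁ z₂) (v₁ z₃) (hp₁ h₂₃))) /
            (α (ρ (U.diff (v₂ z₁) (v₁ z₁) (hp z₁))) (ρ (U.diff (v₁ z₁) (v₁ z₂) (hp₁ h₁₂)))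
                (ρ (U.diff (v₁ z₂) (v₁ z₃) (hp₁ h₂₃))) *
              α (ρ (U.diff (v₂ z₁) (v₂ z₂) (hp₂ h₁₂))) (ρ (U.diff (v₂ z₂) (v₂ z₃) (hp₂ h₂₃)))
                (ρ (U.diff (v₂ z₃) (v₁ z₃) (hp z₃)))))) :
    IsCoboundary₂ fun a b => F.cochain a b / F'.cochain a b := by
  have hfst : Continuous fun p : Z.Fib₂ => p.1.1 := by fun_prop
  have hsnd : Continuous fun p : Z.Fib₂ => p.1.2 := by fun_prop
  have hk := U.isLocallyConstant_diff_comp hv₂ hv₁ hp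
  have hr := U.isLocallyConstant_diff_comp (hv₁.comp hfst) (hv₁.comp hsnd) fun p => hp₁ p.2
  have hs := U.isLocallyConstant_diff_comp (hv₂.comp hfst) (hv₂.comp hsnd) fun p => hp₂ p.2
  -- This quotient is the mixed term of `associator_ratio`. Dividing `η` by it removes `α` and moves
  -- the second cochain from `v₂` to `v₁`, where the first one is evaluated.
  have hθ := ((hk.comp_continuous hfst).comp₂ hr F'.cochain).div
    (hs.comp₂ (hk.comp_continuous hsnd) F'.cochain)
  rw [← isCoboundary₂_div_const (F.cochain 1 1 / F'.cochain 1 1)]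
  refine U.isCoboundary₂_of_cover ((F.isCocycle₂_cochain_div F').div_const _) Z hv₁ hpv₁
    (hηl.div hθ) fun z₁ z₂ z₃ h₁₂ h₂₃ => ?_
  have hsk : ∀ (z z' : Z.Y) (hz : Z.proj z = Z.proj z'),
      U.diff (v₂ z) (v₂ z') (hp₂ hz) * U.diff (v₂ z') (v₁ z') (hp z') =
        U.diff (v₂ z) (v₁ z) (hp z) * U.diff (v₁ z) (v₁ z') (hp₁ hz) := fun z z' hz =>
    (U.diff_mul (v₂ z) (v₂ z') (v₁ z') (hp₂ hz) (hp z')).symm.trans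
      (U.diff_mul (v₂ z) (v₁ z) (v₁ z') (hp z) (hp₁ hz))
  have hη' := (hη z₁ z₂ z₃ h₁₂ h₂₃).trans
    (congrArg (_ * ·) (F'.associator_ratio (hsk z₁ z₂ h₁₂) (hsk z₂ z₃ h₂₃)))
  rw [← U.diff_mul _ _ _ (hp₁ h₁₂) (hp₁ h₂₃), ← U.diff_mul _ _ _ (hp₂ h₁₂) (hp₂ h₂₃)] at hη'
  replace hη' := congrArg Additive.ofMul hη'
  apply Additive.ofMul.injective
  simp only [Pi.div_apply, Function.comp_apply, ofMul_mul, ofMul_div] at hη' ⊢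
  linear_combination (norm := abel) hη'

theorem isCoboundary₂_of_isIsomorphicOver {F F' : WeakRep α ρ}
    (h : (U.twoBundle F).IsIsomorphicOver (U.twoBundle F')) :
    IsCoboundary₂ fun a b => F.cochain a b / F'.cochain a b := by
  obtain ⟨⟨Z, v₁, v₂, hv₁, hv₂, hpv₁, hpv₂, h, _hl, _hρ, η, hηl, hη⟩, hφ⟩ := h
  have hp : ∀ z, U.proj (v₂ z) = U.proj (v₁ z) := fun z => (hpv₂ z).trans (hpv₁ z).symm
  have hk : ∀ z, h z = ρ (U.diff (v₂ z) (v₁ z) (hp z)) := fun z => by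
    have := U.mkPoint_eq (hφ z 1) (hp z)
    rwa [mul_one, mul_one] at this
  refine U.isCoboundary₂_of_coherence Z hv₁.continuous hv₂.continuous hpv₁ hp
    (fun {z z'} hz => (hpv₁ z).trans (hz.trans (hpv₁ z').symm))
    (fun {z z'} hz => (hpv₂ z).trans (hz.trans (hpv₂ z').symm)) hηl fun z₁ z₂ z₃ h₁₂ h₂₃ => ?_
  rw [← hk, ← hk, ← hk]
  exact hη z₁ z₂ z₃ h₁₂ h₂₃

theorem isIsomorphicOver_of_isCoboundary₂ {F F' : WeakRep α ρ}
    (h : IsCoboundary₂ fun a b => F.cochain a b / F'.cochain a b) :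
    (U.twoBundle F).IsIsomorphicOver (U.twoBundle F') := by
  -- The primitive is taken for the normalized quotient, as the bundles use normalized cochains.
  -- With `h = 1`, normalization of `α` makes its three factors trivial in the coherence equation.
  obtain ⟨κ, hκ⟩ := (isCoboundary₂_div_const (F.cochain 1 1 / F'.cochain 1 1)).mpr h
  refine ⟨
    { Z := U.toCover
      v₁ := id
      v₂ := id
      smooth_v₁ := contMDiff_id
      smooth_v₂ := contMDiff_id
      proj_v₁ := fun _ => rfl
      proj_v₂ := fun _ => rfl
      h := fun _ => 1
      h_isLocallyConstant := IsLocallyConstant.const 1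
      h_rho := fun z₁ z₂ hz => by rw [mul_one, one_mul]
      eta := fun p => κ (U.diff p.1.1 p.1.2 p.2)
      eta_isLocallyConstant := U.diff_isLocallyConstant.comp κ
      eta_gamma := fun z₁ z₂ z₃ h₁₂ h₂₃ => ?_ }, fun z g => ?_⟩
  · dsimp only
    rw [α.one_mid, α.one_left, α.one_right, mul_one, div_one, mul_one]
    change κ (U.diff z₂ z₃ h₂₃) * κ (U.diff z₁ z₂ h₁₂) / κ (U.diff z₁ z₃ (h₁₂.trans h₂₃)) =
      F.cochain (U.diff z₁ z₂ h₁₂) (U.diff z₂ z₃ h₂₃) / F.cochain 1 1 /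
        (F'.cochain (U.diff z₁ z₂ h₁₂) (U.diff z₂ z₃ h₂₃) / F'.cochain 1 1)
    rw [U.diff_mul z₁ z₂ z₃ h₁₂ h₂₃, mul_comm (κ _), ← hκ, div_div_div_comm]
  · exact congrArg _ (one_mul g).symm

theorem isIsomorphicOver_iff (F F' : WeakRep α ρ) :
    (U.twoBundle F).IsIsomorphicOver (U.twoBundle F') ↔
      IsCoboundary₂ fun a b => F.cochain a b / F'.cochain a b :=
  ⟨U.isCoboundary₂_of_isIsomorphicOver, U.isIsomorphicOver_of_isCoboundary₂⟩

end UniversalCover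

theorem UniversalCover.isIsomorphicOver_iff_pairing_eq {X : Type} [TopologicalSpace X]
    [ChartedSpace (EuclideanSpace ℝ (Fin d)) X] (U : UniversalCover d X)
    {α : NormalizedCocycle3 G A} {ρ : U.Pi1 →* G} {g : ℕ} {a b : Fin g → U.Pi1}
    (hab : IsStandardPresentation a b) (F F' : WeakRep α ρ) {Ψ : U.Pi1 × U.Pi1 →₀ ℤ}
    (hΨ : IsFundamentalCycle Ψ) :
    (U.twoBundle F).IsIsomorphicOver (U.twoBundle F') ↔
      pairing Ψ F.cochain = pairing Ψ F'.cochain := by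
  rw [U.isIsomorphicOver_iff, hab.isCoboundary₂_iff (F.isCocycle₂_cochain_div F') hΨ, pairing_div,
    div_eq_one]

end Classification

end FlatTwoBundles

/-! ### The main theorem -/

open FlatTwoBundles
theorem mainTheorem4 {G : Type*} [Group G] (α : NormalizedCocycle3 G Circle)
    {S : Type} [TopologicalSpace S] [ChartedSpace (EuclideanSpace ℝ (Fin 2)) S]
    [IsManifold (𝓡 2) ∞ S] [T2Space S] [CompactSpace S] [ConnectedSpace S]
    (U : UniversalCover 2 S) {g : ℕ} (hg : 1 ≤ g) (a b : Fin g → U.Pi1)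
    (hab : IsStandardPresentation a b) (ρ : U.Pi1 →* G) :
    IsFundamentalCycle (surfaceChain (List.ofFn fun i => (a i, b i))) ∧
    ∀ F F' : WeakRep α ρ,
      TwoGroup.label (F.categorifiedRelation _ hab.commProd_eq_one) *
          pairing (surfaceChain (List.ofFn fun i => (a i, b i))) F.cochain =
        TwoGroup.label (F'.categorifiedRelation _ hab.commProd_eq_one) *
          pairing (surfaceChain (List.ofFn fun i => (a i, b i))) F'.cochain ∧
      ((U.twoBundle F).IsIsomorphicOver (U.twoBundle F') ↔
        F.categorifiedRelation _ hab.commProd_eq_one =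
          F'.categorifiedRelation _ hab.commProd_eq_one) ∧
      ∀ Ψ : U.Pi1 × U.Pi1 →₀ ℤ, IsFundamentalCycle Ψ →
        ((U.twoBundle F).IsIsomorphicOver (U.twoBundle F') ↔
          pairing Ψ F.cochain = pairing Ψ F'.cochain) := by
  have hfund := hab.isFundamentalCycle_surfaceChain
  refine ⟨hfund, fun F F' => ⟨F.label_categorifiedRelation_mul_pairing F' _ _, ?_,
    fun Ψ hΨ => U.isIsomorphicOver_iff_pairing_eq hab F F' hΨ⟩⟩
  rw [F.categorifiedRelation_eq_iff F', U.isIsomorphicOver_iff_pairing_eq hab F F' hfund]
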